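/- Work in $\mathbb{C}[[x,y_1,y_2]]$ with maximal ideal $\mathfrak m$, let $\omega=\frac{dy_1\wedge dy_2}{x}$, and let $\langle dx\rangle$ be the ideal generated by $dx$ in the algebra of formal differential forms. A formal diffeomorphism $\Phi$ of $(\mathbb{C}^3,0)$ is transversally symplectic if $\Phi^*(x)=x$ and $x\,\Phi^*(\omega)\in x\,\omega+\langle dx\rangle$; a formal vector field $Y$ vanishing at the origin is transversally Hamiltonian if $\mathcal L_Y(dx)\in\langle dx\rangle$ and $x\,\mathcal L_Y(\omega)\in\langle dx\rangle$. Let $\lambda\in\mathbb{C}^*$, and let $Y$ be a transversally Hamiltonian doubly-resonant saddle-node with eigenvalue $\lambda$, i.e. a transversally Hamiltonian formal vector field which is conjugate by a transversally symplectic formal diffeomorphism to one of the form $$x^2\partial_x+(-\lambda y_1+F_1)\partial_{y_1}+(\lambda y_2+F_2)\partial_{y_2},\qquad F_1,F_2\in\mathfrak m^2 .$$ Then there are $a_1,a_2\in\mathbb{C}$ with $a_1+a_2=1$, a series $c\in v\,\mathbb{C}[[v]]$ and a transversally symplectic formal diffeomorphism $\Phi$ such that, with $v:=y_1y_2$, $$\Phi_*(Y)=x^2\partial_x+(-\lambda+a_1x-c(v))\,y_1\partial_{y_1}+(\lambda+a_2x+c(v))\,y_2\partial_{y_2}.$$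 Moreover $a_1+a_2$ is the residue of $Y$: whenever a diffeomorphism of the form $(x,\mathbf y)\mapsto(x,\phi(x,\mathbf y))$ conjugates $Y$ to $Z=x^2\partial_x+(-\mu y_1+G_1)\partial_{y_1}+(\mu y_2+G_2)\partial_{y_2}$ with $\mu\in\mathbb C^*$ and $G_1,G_2\in\mathfrak m^2$, and $A(x)$ is the matrix of the linear part in $\mathbf y$ along $\mathbf y=0$ of the $\mathbf y$-components of $Z$, the number $\operatorname{res}Y=\left(\operatorname{Tr}A(x)/x\right)_{|x=0}$ equals $a_1+a_2=1$. For the given $\lambda$ this normal form is unique under the action of the group of transversally symplectic diffeomorphisms: $a_1$, $a_2$ and $c$ are uniquely determined by $Y$ and $\lambda$. If the sign of $\lambda$ is not prescribed, the parameters of the normal forms of $Y$ (with nonzero eigenvalue, $a_1+a_2=1$ and $c\in v\,\mathbb{C}[[v]]$) are exactly $(\lambda,a_1,a_2,c(v))$ and $(-\lambda,a_2,a_1,-c(-v))$. -/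

import Mathlib

open MvPowerSeries

noncomputable section

namespace SaddleNode

/-- The algebra `ℂ⟦x, y₁, y₂⟧`; the variables `x, y₁, y₂` have the indices `0, 1, 2`. -/
abbrev Series : Type := MvPowerSeries (Fin 3) ℂ

/-- Formal vector fields `Y = Y₀ ∂_x + Y₁ ∂_{y₁} + Y₂ ∂_{y₂}`, given by their components. -/
abbrev VField : Type := Fin 3 → Series

/-- Formal maps `(x, y₁, y₂) ↦ (φ₀, φ₁, φ₂)`, given by their components. -/
abbrev FMap : Type := Fin 3 → Series

/-- The formal partial derivative with respect to the `i`-th variable. -/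
abbrev pd (i : Fin 3) (f : Series) : Series := MvPowerSeries.pderiv ℂ i f

/-- The vector field vanishes at the origin. -/
def IsSingular (Y : VField) : Prop := ∀ i, constantCoeff (Y i) = 0

/-- Formal diffeomorphisms fixing the origin: `Φ(0) = 0` and `D₀Φ ∈ GL₃(ℂ)`. -/
structure IsDiffeo (Φ : FMap) : Prop where
  zero : ∀ i, constantCoeff (Φ i) = 0
  jac : IsUnit (Matrix.of fun i j : Fin 3 => constantCoeff (pd j (Φ i))).det

/-- The pull-back `Φ^* f = f ∘ Φ` of a formal series. -/
def pull (Φ : FMap) (f : Series) : Series := MvPowerSeries.subst Φ f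

/-- The Lie derivative of a series, `L_Y f = ∑ᵢ Yᵢ ∂ᵢ f`. -/
def lie (Y : VField) (f : Series) : Series := ∑ i, Y i * pd i f

/-- `Z = Φ_* Y = (DΦ · Y) ∘ Φ⁻¹`, written as `DΦ · Y = Z ∘ Φ`. -/
def IsPushforward (Φ : FMap) (Y Z : VField) : Prop :=
  ∀ i, ∑ j, pd j (Φ i) * Y j = pull Φ (Z i)

/-- Fibered diffeomorphisms: those of the form `(x, y) ↦ (x, φ(x, y))`. -/
structure IsFibered (Φ : FMap) : Prop where
  diffeo : IsDiffeo Φ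
  fib : Φ 0 = X 0

/-! ### Differential forms -/

/-- Formal 1-forms `α = ∑ᵢ αᵢ dxᵢ`. -/
abbrev Form1 : Type := Fin 3 → Series

/-- Formal 2-forms, given by their (antisymmetric) matrix of components `η i j = η(∂ᵢ, ∂ⱼ)`. -/
abbrev Form2 : Type := Matrix (Fin 3) (Fin 3) Series

/-- The differential of a series. -/
def diff (f : Series) : Form1 := fun i => pd i f

/-- The exterior product of two 1-forms. -/
def wedge (α β : Form1) : Form2 := Matrix.of fun i j => α i * β j - α j * β i

/-- The 1-form `dx`. -/
def dx : Form1 := diff (X 0)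

/-- The 2-form `dy₁ ∧ dy₂`; the rational form `ω` is `x⁻¹ dy₁ ∧ dy₂`. -/
def dy₁dy₂ : Form2 := wedge (diff (X 1)) (diff (X 2))

/-- Lie derivative of a 1-form, `(L_Y α)ᵢ = Y(αᵢ) + ∑ₖ αₖ ∂ᵢYₖ`. -/
def lie1 (Y : VField) (α : Form1) : Form1 :=
  fun i => lie Y (α i) + ∑ k, α k * pd i (Y k)

/-- Lie derivative of a 2-form,
`(L_Y η)ᵢⱼ = Y(ηᵢⱼ) + ∑ₖ ηₖⱼ ∂ᵢYₖ + ∑ₖ ηᵢₖ ∂ⱼYₖ`. -/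
def lie2 (Y : VField) (η : Form2) : Form2 :=
  Matrix.of fun i j =>
    lie Y (η i j) + ∑ k, η k j * pd i (Y k) + ∑ k, η i k * pd j (Y k)

/-- Pull-back of a 2-form, `(Φ^* η)ᵢⱼ = ∑ₖₗ (ηₖₗ ∘ Φ) ∂ᵢφₖ ∂ⱼφₗ`. -/
def pull2 (Φ : FMap) (η : Form2) : Form2 :=
  Matrix.of fun i j => ∑ k, ∑ l, pull Φ (η k l) * pd i (Φ k) * pd j (Φ l)

/-- The 1-form belongs to the ideal `⟨dx⟩`. -/
def InIdealDx1 (α : Form1) : Prop := ∃ f : Series, α = f • dx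

/-- The 2-form belongs to the ideal `⟨dx⟩`. -/
def InIdealDx2 (η : Form2) : Prop := ∃ α : Form1, η = wedge dx α

/-- `η = x L_Y(ω)` for `ω = x⁻¹ θ`, `θ = dy₁ ∧ dy₂`. Since
`L_Y(x⁻¹ θ) = - x⁻² L_Y(x) θ + x⁻¹ L_Y(θ)`, this is the equation below, multiplied by `x`. -/
def IsXLieOmega (Y : VField) (η : Form2) : Prop :=
  (X 0 : Series) • η = (X 0 : Series) • lie2 Y dy₁dy₂ - lie Y (X 0) • dy₁dy₂

/-- Transversally Hamiltonian singular vector fields (with respect to `ω` and `dx`):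
`L_Y(dx) ∈ ⟨dx⟩` and `x L_Y(ω) ∈ ⟨dx⟩`. -/
structure IsTransHamiltonian (Y : VField) : Prop where
  singular : IsSingular Y
  lie_dx : InIdealDx1 (lie1 Y dx)
  lie_omega : ∃ η : Form2, IsXLieOmega Y η ∧ InIdealDx2 η

/-- Transversally symplectic diffeomorphisms (with respect to `ω` and `dx`):
`Φ^*(x) = x` and `x Φ^*(ω) ∈ x ω + ⟨dx⟩`. As `Φ^*(x) = x`, one has
`x Φ^*(ω) = Φ^*(dy₁ ∧ dy₂)`. -/
structure IsTransSymplectic (Φ : FMap) : Prop where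
  diffeo : IsDiffeo Φ
  pull_x : pull Φ (X 0) = X 0
  pull_omega : InIdealDx2 (pull2 Φ dy₁dy₂ - dy₁dy₂)

/-! ### Doubly-resonant saddle-nodes -/

/-- Vector fields of the form
`x² ∂_x + (-λ y₁ + F₁) ∂_{y₁} + (λ y₂ + F₂) ∂_{y₂}` with `F₁, F₂ ∈ 𝔪²`. -/
def IsPrepared (lam : ℂ) (Z : VField) : Prop :=
  ∃ F₁ F₂ : Series, 2 ≤ F₁.order ∧ 2 ≤ F₂.order ∧
    Z = ![X 0 ^ 2, -(C lam * X 1) + F₁, C lam * X 2 + F₂]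

/-- `Y` is a transversally Hamiltonian doubly-resonant saddle-node with eigenvalue `λ ≠ 0`: it is
transversally Hamiltonian and is mapped by a transversally symplectic diffeomorphism to the form
`x² ∂_x + (-λ y₁ + F₁) ∂_{y₁} + (λ y₂ + F₂) ∂_{y₂}`, with `F₁, F₂ ∈ 𝔪²`. -/
def IsTransHamSaddleNode (lam : ℂ) (Y : VField) : Prop :=
  lam ≠ 0 ∧ IsTransHamiltonian Y ∧
    ∃ (Φ : FMap) (Z : VField), IsTransSymplectic Φ ∧ IsPushforward Φ Y Z ∧ IsPrepared lam Z

/-- For a prepared vector field `x² ∂_x + …`, with linear part `A(x)` in `y` along `y = 0`, the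
number `(Tr A(x) / x)|_{x = 0}`, that is, the coefficient of `x` in
`Tr A(x) = (∂Z₁/∂y₁ + ∂Z₂/∂y₂)(x, 0, 0)`. -/
def preparedResidue (Z : VField) : ℂ :=
  coeff (Finsupp.single 0 1) (pd 1 (Z 1) + pd 2 (Z 2))

/-- `r` is a residue of `Y`: it is computed from a prepared vector field to which `Y` is conjugate
by a fibered diffeomorphism. -/
def HasResidue (Y : VField) (r : ℂ) : Prop :=
  ∃ (lam : ℂ) (Φ : FMap) (Z : VField), lam ≠ 0 ∧ IsFibered Φ ∧ IsPushforward Φ Y Z ∧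
    IsPrepared lam Z ∧ preparedResidue Z = r

/-- The series `c(v)`, `v = y₁ y₂`. -/
def ofV (c : PowerSeries ℂ) : Series := PowerSeries.subst (X 1 * X 2 : Series) c

/-- The vector field
`x² ∂_x + (-λ + a₁ x - c(v)) y₁ ∂_{y₁} + (λ + a₂ x + c(v)) y₂ ∂_{y₂}`, `v = y₁ y₂`. -/
def normalForm (lam a₁ a₂ : ℂ) (c : PowerSeries ℂ) : VField :=
  ![X 0 ^ 2,
    (-C lam + C a₁ * X 0 - ofV c) * X 1,
    (C lam + C a₂ * X 0 + ofV c) * X 2]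

/-- `(λ, a₁, a₂, c)` are the parameters of a normal form of `Y`: `λ ≠ 0`, `a₁ + a₂ = 1`,
`c ∈ v ℂ⟦v⟧`, and some transversally symplectic diffeomorphism maps `Y` to the vector field
`normalForm λ a₁ a₂ c`. -/
def HasNormalForm (Y : VField) (lam a₁ a₂ : ℂ) (c : PowerSeries ℂ) : Prop :=
  lam ≠ 0 ∧ a₁ + a₂ = 1 ∧ PowerSeries.constantCoeff c = 0 ∧
    ∃ Φ : FMap, IsTransSymplectic Φ ∧ IsPushforward Φ Y (normalForm lam a₁ a₂ c)

end SaddleNode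

end

/-! A transversally symplectic map is exactly a map fixing `x` whose Jacobian along the fibres of
`x` is 1 (`isTransSymplectic_iff`), and a transversally Hamiltonian field with `x`-component `x²`
has fibre divergence `x`. The statement thus becomes one about Jacobians and divergences, linked by
a Liouville formula (`pull_fdiv_mul_jac`).

Everything is organised by the torus field `y₁∂₁ - y₂∂₂`, diagonal on monomials: the linear part of
a prepared field is `-λ` times it. The rigidity lemma `HasLinearPart.lie_torus_eq` says that a
solution `K` of `N(K) = (r - λκ)K`, with `N` resonant and `r` torus-invariant without constant term,
is a torus eigenvector of weight `κ`.

Existence. A Poincaré–Dulac map makes the field resonant but need not be symplectic. Its Jacobian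
solves such an equation, hence is torus-invariant, and an equivariant map with the same Jacobian
corrects it. What remains is `x²∂ₓ + P₁y₁∂₁ + P₂y₂∂₂` with `P₁ + P₂ = x`; a map `(x, t y₁, t⁻¹y₂)`,
with `t` from an Euler equation, removes every other multiple of `x` from `P₁`, leaving `a₁x`.

Uniqueness. By rigidity a conjugacy between normal forms is torus-equivariant. Jacobian 1 then
forces `φ₁φ₂ = y₁y₂`, and the `y₁`-equation gives `c` at `x = 0` and `a₁` after division by `x`. The
linear part allows only `±λ`, exchanged by `swap`. The residue is 1 because the Liouville formula,
read at the coefficient of `x`, leaves it unchanged. -/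

noncomputable section

namespace SaddleNode

/-! ### Order of vanishing, fixed points and the chain rule for formal series -/

section Order

variable {σ τ : Type*}

/-- All coefficients of degree less than `n` vanish. -/
def OrdGE (n : ℕ) (f : MvPowerSeries σ ℂ) : Prop := ∀ d : σ →₀ ℕ, d.degree < n → coeff d f = 0

theorem ordGE_iff_le_order {n : ℕ} {f : MvPowerSeries σ ℂ} : OrdGE n f ↔ (n : ℕ∞) ≤ f.order :=
  ⟨fun h => nat_le_order h, fun h d hd =>
    coeff_of_lt_order (lt_of_lt_of_le (by exact_mod_cast hd) h)⟩

namespace OrdGE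

variable {m n : ℕ} {f g : MvPowerSeries σ ℂ}

theorem zero : OrdGE n (0 : MvPowerSeries σ ℂ) := fun _ _ => by simp

theorem mono (h : OrdGE n f) (hmn : m ≤ n) : OrdGE m f := fun d hd => h d (by omega)

theorem of_zero : OrdGE 0 f := fun _ hd => by omega

theorem add (hf : OrdGE n f) (hg : OrdGE n g) : OrdGE n (f + g) := fun d hd => by
  simp [hf d hd, hg d hd]

theorem neg (hf : OrdGE n f) : OrdGE n (-f) := fun d hd => by simp [hf d hd]

theorem sub (hf : OrdGE n f) (hg : OrdGE n g) : OrdGE n (f - g) := fun d hd => by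
  simp [hf d hd, hg d hd]

theorem mul (hf : OrdGE m f) (hg : OrdGE n g) : OrdGE (m + n) (f * g) := by
  rw [ordGE_iff_le_order] at *
  push_cast
  exact (add_le_add hf hg).trans le_order_mul

theorem mul_left (hf : OrdGE n f) (g : MvPowerSeries σ ℂ) : OrdGE n (g * f) :=
  ((of_zero (f := g)).mul hf).mono (by omega)

theorem mul_right (hf : OrdGE n f) (g : MvPowerSeries σ ℂ) : OrdGE n (f * g) :=
  (hf.mul (of_zero (f := g))).mono (by omega)

theorem sum {ι : Type*} {s : Finset ι} {f : ι → MvPowerSeries σ ℂ} (h : ∀ i ∈ s, OrdGE n (f i)) :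
    OrdGE n (∑ i ∈ s, f i) := fun d hd => by
  rw [map_sum]
  exact Finset.sum_eq_zero fun i hi => h i hi d hd

theorem X (i : σ) : OrdGE 1 (X i : MvPowerSeries σ ℂ) := fun d hd => by
  have : d = 0 := (Finsupp.degree_eq_zero_iff d).1 (by omega)
  simp [this]

theorem pderiv (hf : OrdGE (n + 1) f) (i : σ) : OrdGE n (pderiv ℂ i f) := fun d hd => by
  rw [coeff_pderiv, hf _ (by simpa using hd), zero_mul]

end OrdGE

theorem ordGE_one_iff {f : MvPowerSeries σ ℂ} : OrdGE 1 f ↔ constantCoeff f = 0 := by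
  constructor
  · intro h
    simpa using h 0 (by simp)
  · intro h d hd
    have : d = 0 := (Finsupp.degree_eq_zero_iff d).1 (by omega)
    simpa [this] using h

theorem eq_zero_of_forall_ordGE {f : MvPowerSeries σ ℂ} (h : ∀ n, OrdGE n f) : f = 0 := by
  ext d
  simpa using h (d.degree + 1) d (by omega)

theorem hasSubst_of_ordGE [Finite σ] {a : σ → MvPowerSeries τ ℂ} (ha : ∀ i, OrdGE 1 (a i)) :
    HasSubst a :=
  hasSubst_of_constantCoeff_zero fun i => ordGE_one_iff.1 (ha i)

theorem OrdGE.subst [Finite σ] {a : σ → MvPowerSeries τ ℂ} (ha : ∀ i, OrdGE 1 (a i))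
    {n : ℕ} {f : MvPowerSeries σ ℂ} (hf : OrdGE n f) : OrdGE n (subst a f) := by
  rw [ordGE_iff_le_order] at hf ⊢
  refine le_trans ?_ (le_order_subst (hasSubst_of_ordGE ha) f)
  have h1 : (1 : ℕ∞) ≤ ⨅ i, (a i).order := le_iInf fun i => by
    exact_mod_cast ordGE_iff_le_order.1 (ha i)
  calc (n : ℕ∞) = 1 * n := by simp
    _ ≤ _ := mul_le_mul' h1 hf

theorem prod_pow_add_single (a : σ → MvPowerSeries τ ℂ) (d : σ →₀ ℕ) (s : σ) :
    (d + Finsupp.single s 1).prod (fun s e => a s ^ e) = d.prod (fun s e => a s ^ e) * a s := by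
  classical
  rw [Finsupp.prod_add_index' (by simp) (by intros; exact pow_add _ _ _),
    Finsupp.prod_single_index (by simp), pow_one]

theorem exists_add_single {d : σ →₀ ℕ} (hd : d ≠ 0) :
    ∃ (e : σ →₀ ℕ) (s : σ), d = e + Finsupp.single s 1 := by
  obtain ⟨s, hs⟩ := Finsupp.ne_iff.1 hd
  refine ⟨d - Finsupp.single s 1, s, (tsub_add_cancel_of_le ?_).symm⟩
  rw [Finsupp.single_le_iff]
  exact Nat.one_le_iff_ne_zero.2 hs

/-- Replace the `k` factors one at a time: each replacement gains order `n`, the other `k - 1`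
factors order one each. Writing `m + 1 ≤ n + k` avoids a truncated subtraction. -/
theorem ordGE_prod_pow_sub {a b : σ → MvPowerSeries τ ℂ} (ha : ∀ i, OrdGE 1 (a i))
    (hb : ∀ i, OrdGE 1 (b i)) {n : ℕ} (hab : ∀ i, OrdGE n (a i - b i)) (k : ℕ) :
    ∀ d : σ →₀ ℕ, d.degree = k → OrdGE k (d.prod fun s e => a s ^ e) ∧
      ∀ m, m + 1 ≤ n + k →
      OrdGE m ((d.prod fun s e => a s ^ e) - d.prod fun s e => b s ^ e) := by
  induction k with
  | zero =>
    intro d hd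
    have : d = 0 := (Finsupp.degree_eq_zero_iff d).1 (by omega)
    subst this
    simp [OrdGE.of_zero, OrdGE.zero]
  | succ k ih =>
    intro d hd
    obtain ⟨e, s, rfl⟩ := exists_add_single (d := d) (by rintro rfl; simp at hd)
    have he : e.degree = k := by simpa using hd
    obtain ⟨h1, h2⟩ := ih e he
    rw [prod_pow_add_single, prod_pow_add_single]
    refine ⟨h1.mul (ha s), fun m hm => ?_⟩
    have : ∀ A B x y : MvPowerSeries τ ℂ, A * x - B * y = A * (x - y) + (A - B) * y := by
      intros; ring
    rw [this]
    refine ((h1.mul (hab s)).mono (by omega)).add ?_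
    rcases m with _ | m
    · exact .of_zero
    · exact (h2 m (by omega)).mul (hb s)

/-- Source of the contractions below: for `f` of order at least 2, `a ↦ f ∘ a` increases the order
of contact. -/
theorem OrdGE.subst_sub_subst [Finite σ] {a b : σ → MvPowerSeries τ ℂ}
    (ha : ∀ i, OrdGE 1 (a i)) (hb : ∀ i, OrdGE 1 (b i)) {n k : ℕ}
    (hab : ∀ i, OrdGE n (a i - b i)) {f : MvPowerSeries σ ℂ} (hf : OrdGE (k + 1) f) :
    OrdGE (n + k) (MvPowerSeries.subst a f - MvPowerSeries.subst b f) := by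
  intro e he
  rw [map_sub, coeff_subst (hasSubst_of_ordGE ha), coeff_subst (hasSubst_of_ordGE hb), sub_eq_zero]
  refine finsum_congr fun d => ?_
  by_cases hd : d.degree < k + 1
  · simp [hf d hd]
  · congr 1
    have := (ordGE_prod_pow_sub ha hb hab _ d rfl).2 (n + k) (by omega) e he
    rwa [map_sub, sub_eq_zero] at this

/-- A map between tuples of series which increases the order of contact has a fixed point. -/
theorem exists_fixedPoint {ι : Type*} (T : (ι → MvPowerSeries σ ℂ) → ι → MvPowerSeries σ ℂ) (k : ℕ)
    (hmaps : ∀ f, (∀ i, OrdGE k (f i)) → ∀ i, OrdGE k (T f i))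
    (hcontr : ∀ f g n, (∀ i, OrdGE k (f i)) → (∀ i, OrdGE k (g i)) → k ≤ n →
      (∀ i, OrdGE n (f i - g i)) → ∀ i, OrdGE (n + 1) (T f i - T g i)) :
    ∃ f, (∀ i, OrdGE k (f i)) ∧ T f = f := by
  let s : ℕ → ι → MvPowerSeries σ ℂ := fun n => T^[n] 0
  have hs : ∀ n, s (n + 1) = T (s n) := fun n => Function.iterate_succ_apply' T n 0
  have hk : ∀ n i, OrdGE k (s n i) := by
    intro n
    induction n with
    | zero => exact fun i => .zero
    | succ n ih => rw [hs]; exact hmaps _ ih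
  have hstep : ∀ n i, OrdGE (k + n) (s (n + 1) i - s n i) := by
    intro n
    induction n with
    | zero => exact fun i => (hk _ i).sub (hk _ i)
    | succ n ih =>
      rw [hs (n + 1), hs n]
      exact hcontr _ _ (k + n) (hs n ▸ hk _) (hk _) (by omega) (hs n ▸ ih)
  have hcauchy : ∀ n m i, OrdGE (k + n) (s (n + m) i - s n i) := by
    intro n m i
    induction m with
    | zero => simpa using OrdGE.zero
    | succ m ih =>
      have := ((hstep (n + m) i).mono (by omega : k + n ≤ _)).add ih
      simpa [add_assoc] using this
  -- The coefficient at `d` no longer changes from iterate `d.degree + 1` on, so this is the formal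
  -- limit.
  let f : ι → MvPowerSeries σ ℂ := fun i d => coeff d (s (d.degree + 1) i)
  have hcoeff : ∀ i d, coeff d (f i) = coeff d (s (d.degree + 1) i) := fun i d => rfl
  have hlim : ∀ n i, OrdGE (k + n) (f i - s n i) := by
    intro n i d hd
    rw [map_sub, hcoeff]
    rcases le_total n (d.degree + 1) with h | h
    · obtain ⟨m, hm⟩ := Nat.exists_eq_add_of_le h
      rw [hm, ← map_sub]
      exact hcauchy n m i d hd
    · obtain ⟨m, hm⟩ := Nat.exists_eq_add_of_le h
      have := hcauchy (d.degree + 1) m i d (by omega)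
      rw [← hm, map_sub] at this
      rw [← neg_eq_zero, neg_sub, this]
  have hfk : ∀ i, OrdGE k (f i) := fun i => by
    have := hlim 0 i
    simpa [s] using this
  refine ⟨f, hfk, funext fun i => sub_eq_zero.1 (eq_zero_of_forall_ordGE fun n => ?_)⟩
  have h1 := hcontr f (s n) (k + n) hfk (hk n) (by omega) (hlim n) i
  have h2 := hlim (n + 1) i
  rw [hs] at h2
  have := (h1.mono (by omega : n ≤ _)).sub (h2.mono (by omega : n ≤ _))
  simpa using this

/-- The chain rule for the substitution of series without constant term. -/
theorem pderiv_subst [Fintype σ] {a : σ → MvPowerSeries τ ℂ} (ha : ∀ i, OrdGE 1 (a i)) (t : τ)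
    (f : MvPowerSeries σ ℂ) :
    pderiv ℂ t (subst a f) = ∑ s, subst a (pderiv ℂ s f) * pderiv ℂ t (a s) := by
  classical
  have hs := hasSubst_of_ordGE ha
  have hadd : ∀ f g : MvPowerSeries σ ℂ,
      pderiv ℂ t (subst a f) = ∑ s, subst a (pderiv ℂ s f) * pderiv ℂ t (a s) →
      pderiv ℂ t (subst a g) = ∑ s, subst a (pderiv ℂ s g) * pderiv ℂ t (a s) →
      pderiv ℂ t (subst a (f + g)) = ∑ s, subst a (pderiv ℂ s (f + g)) * pderiv ℂ t (a s) := by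
    intro f g hf hg
    simp only [subst_add hs, map_add, hf, hg, add_mul, Finset.sum_add_distrib]
  have hpoly : ∀ p : MvPolynomial σ ℂ, pderiv ℂ t (subst a (p : MvPowerSeries σ ℂ)) =
      ∑ s, subst a (pderiv ℂ s (p : MvPowerSeries σ ℂ)) * pderiv ℂ t (a s) := by
    intro p
    induction p using MvPolynomial.induction_on with
    | C c =>
      have h0 : subst a (0 : MvPowerSeries σ ℂ) = 0 := by
        rw [← coe_substAlgHom hs, map_zero]
      rw [MvPolynomial.coe_C]
      simp [subst_C, h0]
    | add p q hp hq => rw [MvPolynomial.coe_add]; exact hadd _ _ hp hq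
    | mul_X p s hp =>
      rw [MvPolynomial.coe_mul, MvPolynomial.coe_X, subst_mul hs, Derivation.leibniz, hp]
      have h1 : subst a (1 : MvPowerSeries σ ℂ) = 1 := by rw [← coe_substAlgHom hs, map_one]
      have h0 : subst a (0 : MvPowerSeries σ ℂ) = 0 := by rw [← coe_substAlgHom hs, map_zero]
      simp only [Derivation.leibniz, smul_eq_mul, subst_add hs, subst_mul hs, subst_X hs,
        add_mul, Finset.sum_add_distrib, Finset.mul_sum]
      congr 1
      · rw [Finset.sum_eq_single s]
        · simp [h1]
        · intro b _ hb
          simp [pderiv_X_of_ne hb.symm, h0]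
        · simp
      · simp [mul_assoc]
  -- The formula holds for the truncation of `f`; the tail of order `n + 1` contributes only terms
  -- of order `n` to both sides.
  refine sub_eq_zero.1 (eq_zero_of_forall_ordGE fun n => ?_)
  obtain ⟨p, H, hpH, hH⟩ : ∃ (p : MvPolynomial σ ℂ) (H : MvPowerSeries σ ℂ),
      f = p + H ∧ OrdGE (n + 1) H := by
    refine ⟨truncTotal (n + 1) f, f - truncTotal (n + 1) f, by ring, fun d hd => ?_⟩
    rw [map_sub, MvPolynomial.coeff_coe, coeff_truncTotal _ hd, sub_self]
  have hsplit : pderiv ℂ t (subst a f) - ∑ s, subst a (pderiv ℂ s f) * pderiv ℂ t (a s) =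
      pderiv ℂ t (subst a H) - ∑ s, subst a (pderiv ℂ s H) * pderiv ℂ t (a s) := by
    rw [hpH]
    simp only [subst_add hs, map_add, hpoly, add_mul, Finset.sum_add_distrib]
    ring
  rw [hsplit]
  refine ((hH.subst ha).pderiv t).sub (OrdGE.sum fun s _ => ?_)
  exact ((hH.pderiv s).subst ha).mul_right _

end Order

theorem coeff_single_X (i j : Fin 3) :
    coeff (Finsupp.single i 1) (X j : Series) = if i = j then 1 else 0 := by
  rw [coeff_X]
  simp [Finsupp.single_left_inj (one_ne_zero)]

theorem X_ne_zero (i : Fin 3) : (X i : Series) ≠ 0 := fun h => by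
  simpa [coeff_single_X] using congrArg (coeff (Finsupp.single i 1)) h

/-! ### Pull-backs -/

theorem IsDiffeo.ordGE {Φ : FMap} (hΦ : IsDiffeo Φ) (i : Fin 3) : OrdGE 1 (Φ i) :=
  ordGE_one_iff.2 (hΦ.zero i)

theorem pull_add {Φ : FMap} (hΦ : ∀ i, OrdGE 1 (Φ i)) (f g : Series) :
    pull Φ (f + g) = pull Φ f + pull Φ g := subst_add (hasSubst_of_ordGE hΦ) f g

theorem pull_sub {Φ : FMap} (hΦ : ∀ i, OrdGE 1 (Φ i)) (f g : Series) :
    pull Φ (f - g) = pull Φ f - pull Φ g := subst_sub (hasSubst_of_ordGE hΦ) f g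

theorem pull_mul {Φ : FMap} (hΦ : ∀ i, OrdGE 1 (Φ i)) (f g : Series) :
    pull Φ (f * g) = pull Φ f * pull Φ g := subst_mul (hasSubst_of_ordGE hΦ) f g

theorem pull_pow {Φ : FMap} (hΦ : ∀ i, OrdGE 1 (Φ i)) (f : Series) (n : ℕ) :
    pull Φ (f ^ n) = pull Φ f ^ n := subst_pow (hasSubst_of_ordGE hΦ) f n

theorem pull_X {Φ : FMap} (hΦ : ∀ i, OrdGE 1 (Φ i)) (i : Fin 3) : pull Φ (X i) = Φ i :=
  subst_X (hasSubst_of_ordGE hΦ) i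

theorem pull_C (Φ : FMap) (c : ℂ) : pull Φ (C c) = C c := subst_C c

theorem pull_zero (Φ : FMap) : pull Φ 0 = 0 := by simpa using pull_C Φ 0

theorem pull_one (Φ : FMap) : pull Φ 1 = 1 := by simpa using pull_C Φ 1

theorem pull_neg {Φ : FMap} (hΦ : ∀ i, OrdGE 1 (Φ i)) (f : Series) :
    pull Φ (-f) = -pull Φ f := by
  have := pull_sub hΦ 0 f
  simpa [pull_zero] using this

theorem pull_sum {Φ : FMap} (hΦ : ∀ i, OrdGE 1 (Φ i)) {ι : Type*} (s : Finset ι) (f : ι → Series) :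
    pull Φ (∑ i ∈ s, f i) = ∑ i ∈ s, pull Φ (f i) := by
  simp only [pull, ← coe_substAlgHom (R := ℂ) (hasSubst_of_ordGE hΦ), map_sum]

theorem pull_X_self (f : Series) : pull X f = f := by
  have := subst_self (σ := Fin 3) (R := ℂ)
  exact congrFun this f

theorem OrdGE.pull {Φ : FMap} (hΦ : ∀ i, OrdGE 1 (Φ i)) {n : ℕ} {f : Series} (hf : OrdGE n f) :
    OrdGE n (pull Φ f) := hf.subst hΦ

theorem constantCoeff_pull {Φ : FMap} (hΦ : ∀ i, OrdGE 1 (Φ i)) (f : Series) :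
    constantCoeff (pull Φ f) = constantCoeff f := by
  have h : OrdGE 1 (f - C (constantCoeff f)) := ordGE_one_iff.2 (by simp)
  have := ordGE_one_iff.1 (h.pull hΦ)
  rw [pull_sub hΦ, pull_C] at this
  simpa [sub_eq_zero] using this

theorem pd_pull {Φ : FMap} (hΦ : ∀ i, OrdGE 1 (Φ i)) (i : Fin 3) (f : Series) :
    pd i (pull Φ f) = ∑ j, pull Φ (pd j f) * pd i (Φ j) := pderiv_subst hΦ i f

/-- The composition `Ψ ∘ Φ`. -/
def comp (Ψ Φ : FMap) : FMap := fun i => pull Φ (Ψ i)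

theorem comp_ordGE {Φ Ψ : FMap} (hΦ : ∀ i, OrdGE 1 (Φ i)) (hΨ : ∀ i, OrdGE 1 (Ψ i)) (i : Fin 3) :
    OrdGE 1 (comp Ψ Φ i) := (hΨ i).pull hΦ

theorem pull_comp {Φ Ψ : FMap} (hΦ : ∀ i, OrdGE 1 (Φ i)) (hΨ : ∀ i, OrdGE 1 (Ψ i)) (f : Series) :
    pull (comp Ψ Φ) f = pull Φ (pull Ψ f) :=
  (subst_comp_subst_apply (hasSubst_of_ordGE hΨ) (hasSubst_of_ordGE hΦ) f).symm

/-- The matrix of the derivative at the origin. -/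
def jacMatrix (Φ : FMap) : Matrix (Fin 3) (Fin 3) ℂ :=
  Matrix.of fun i j => constantCoeff (pd j (Φ i))

theorem jacMatrix_comp {Φ Ψ : FMap} (hΦ : ∀ i, OrdGE 1 (Φ i)) :
    jacMatrix (comp Ψ Φ) = jacMatrix Ψ * jacMatrix Φ := by
  ext i j
  simp [jacMatrix, Matrix.mul_apply, comp, pd_pull hΦ, constantCoeff_pull hΦ]

theorem jacMatrix_X : jacMatrix (X : FMap) = 1 := by
  ext i j
  by_cases h : i = j
  · subst h; simp [jacMatrix]
  · simp [jacMatrix, h]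

theorem IsDiffeo.comp {Φ Ψ : FMap} (hΨ : IsDiffeo Ψ) (hΦ : IsDiffeo Φ) :
    IsDiffeo (comp Ψ Φ) where
  zero i := ordGE_one_iff.1 (comp_ordGE hΦ.ordGE hΨ.ordGE i)
  jac := by
    have : IsUnit (jacMatrix (SaddleNode.comp Ψ Φ)).det := by
      rw [jacMatrix_comp hΦ.ordGE, Matrix.det_mul]
      exact hΨ.jac.mul hΦ.jac
    exact this

theorem coeff_single_eq_constantCoeff_pd (i : Fin 3) (f : Series) :
    coeff (Finsupp.single i 1) f = constantCoeff (pd i f) := by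
  have := coeff_pderiv (R := ℂ) (i := i) f 0
  simpa using this.symm

theorem ordGE_two_iff {f : Series} :
    OrdGE 2 f ↔ constantCoeff f = 0 ∧ ∀ i, constantCoeff (pd i f) = 0 := by
  constructor
  · intro h
    exact ⟨ordGE_one_iff.1 (h.mono (by omega)), fun i => ordGE_one_iff.1 (h.pderiv i)⟩
  · rintro ⟨h0, h1⟩ d hd
    by_cases hd0 : d = 0
    · simpa [hd0] using h0
    · obtain ⟨e, s, rfl⟩ := exists_add_single hd0
      have he : e = 0 := (Finsupp.degree_eq_zero_iff e).1 (by simp at hd; omega)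
      rw [he, zero_add, coeff_single_eq_constantCoeff_pd]
      exact h1 s

/-- With `Φ = M·X + H` and `H` of order 2, the inverse is the fixed point of `Ψ ↦ M⁻¹(X - H ∘ Ψ)`.
-/
theorem exists_rightInverse {Φ : FMap} (hΦ : IsDiffeo Φ) :
    ∃ Ψ : FMap, (∀ i, OrdGE 1 (Ψ i)) ∧ comp Φ Ψ = X := by
  let M := jacMatrix Φ
  have hM : M * M⁻¹ = 1 := Matrix.mul_nonsing_inv M hΦ.jac
  let H : FMap := fun i => Φ i - ∑ j, C (M i j) * X j
  have hH : ∀ i, OrdGE 2 (H i) := by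
    intro i
    rw [ordGE_two_iff]
    refine ⟨by simp [H, hΦ.zero], fun k => ?_⟩
    simp only [H, map_sub, map_sum, Derivation.leibniz, smul_eq_mul]
    rw [Finset.sum_eq_single k]
    · simp [M, jacMatrix]
    · intro b _ hb
      simp [pderiv_X_of_ne hb]
    · simp
  obtain ⟨Ψ, h1, h2⟩ := exists_fixedPoint
    (fun (Ψ : FMap) i => ∑ j, C (M⁻¹ i j) * (X j - pull Ψ (H j))) 1
    (fun f hf i => .sum fun j _ => .mul_left ((OrdGE.X j).sub
      (((hH j).mono (by omega)).pull hf)) _)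
    (fun f g n hf hg _ hfg i => by
      rw [← Finset.sum_sub_distrib]
      refine .sum fun j _ => ?_
      rw [← mul_sub]
      refine .mul_left ?_ _
      have := (OrdGE.subst_sub_subst hf hg hfg (hH j)).neg
      convert this using 1
      simp only [pull]
      ring)
  refine ⟨Ψ, h1, funext fun i => ?_⟩
  have hΦi : Φ i = ∑ j, C (M i j) * X j + H i := by simp [H]
  have h3 : ∀ j, Ψ j = ∑ k, C (M⁻¹ j k) * (X k - pull Ψ (H k)) := fun j =>
    (congrFun h2 j).symm
  rw [comp, hΦi, pull_add h1, pull_sum h1]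
  have h4 : ∑ j, pull Ψ (C (M i j) * X j) = X i - pull Ψ (H i) := by
    calc ∑ j, pull Ψ (C (M i j) * X j)
        = ∑ j, C (M i j) * ∑ k, C (M⁻¹ j k) * (X k - pull Ψ (H k)) := by
          refine Finset.sum_congr rfl fun j _ => ?_
          rw [pull_mul h1, pull_C, pull_X h1, ← h3]
      _ = ∑ k, C ((M * M⁻¹) i k) * (X k - pull Ψ (H k)) := by
          simp only [Matrix.mul_apply, map_sum, map_mul, Finset.mul_sum, Finset.sum_mul, mul_assoc]
          exact Finset.sum_comm
      _ = _ := by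
          rw [hM, Finset.sum_eq_single i]
          · simp
          · intro b _ hb
            simp [Matrix.one_apply_ne hb.symm]
          · simp
  rw [h4]
  ring

theorem comp_assoc {Φ Ψ Θ : FMap} (hΨ : ∀ i, OrdGE 1 (Ψ i)) (hΘ : ∀ i, OrdGE 1 (Θ i)) :
    comp (comp Φ Ψ) Θ = comp Φ (comp Ψ Θ) := funext fun i => (pull_comp hΘ hΨ (Φ i)).symm

theorem comp_X (Φ : FMap) : comp Φ X = Φ := funext fun i => pull_X_self (Φ i)

theorem X_comp {Φ : FMap} (hΦ : ∀ i, OrdGE 1 (Φ i)) : comp X Φ = Φ := funext fun i => pull_X hΦ i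

/-- The right inverse has a right inverse of its own, which associativity identifies with `Φ`. -/
theorem IsDiffeo.exists_inverse {Φ : FMap} (hΦ : IsDiffeo Φ) :
    ∃ Ψ : FMap, IsDiffeo Ψ ∧ SaddleNode.comp Φ Ψ = X ∧ SaddleNode.comp Ψ Φ = X := by
  have key : ∀ {Φ : FMap}, IsDiffeo Φ → ∃ Ψ : FMap, IsDiffeo Ψ ∧ SaddleNode.comp Φ Ψ = X := by
    intro Φ hΦ
    obtain ⟨Ψ, h1, h2⟩ := exists_rightInverse hΦ
    refine ⟨Ψ, ⟨fun i => ordGE_one_iff.1 (h1 i), ?_⟩, h2⟩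
    have h3 := congrArg Matrix.det (jacMatrix_comp (Ψ := Φ) h1)
    rw [h2, jacMatrix_X, Matrix.det_mul, Matrix.det_one] at h3
    exact IsUnit.of_mul_eq_one _ ((mul_comm _ _).trans h3.symm)
  obtain ⟨Ψ, h1, h2⟩ := key hΦ
  obtain ⟨Θ, h3, h4⟩ := key h1
  refine ⟨Ψ, h1, h2, ?_⟩
  have : Φ = Θ := by
    have := comp_assoc (Φ := Φ) h1.ordGE h3.ordGE
    rw [h2, h4, comp_X, X_comp h3.ordGE] at this
    exact this.symm
  rw [this, h4]

theorem pull_injective {Φ : FMap} (hΦ : IsDiffeo Φ) {f g : Series} (h : pull Φ f = pull Φ g) :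
    f = g := by
  obtain ⟨Ψ, h1, h2, -⟩ := hΦ.exists_inverse
  have := congrArg (pull Ψ) h
  rwa [← pull_comp h1.ordGE hΦ.ordGE, ← pull_comp h1.ordGE hΦ.ordGE, h2, pull_X_self,
    pull_X_self] at this

/-! ### Vector fields acting on series -/

theorem lie_eq (Y : VField) (f : Series) :
    lie Y f = Y 0 * pd 0 f + Y 1 * pd 1 f + Y 2 * pd 2 f := by
  rw [lie, Fin.sum_univ_three]

theorem lie_add (Y : VField) (f g : Series) : lie Y (f + g) = lie Y f + lie Y g := by
  simp only [lie_eq, map_add]; ring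

theorem lie_sub (Y : VField) (f g : Series) : lie Y (f - g) = lie Y f - lie Y g := by
  simp only [lie_eq, map_sub]; ring

theorem lie_mul (Y : VField) (f g : Series) : lie Y (f * g) = f * lie Y g + g * lie Y f := by
  simp only [lie_eq, Derivation.leibniz, smul_eq_mul]; ring

theorem lie_C (Y : VField) (c : ℂ) : lie Y (C c) = 0 := by simp [lie_eq]

theorem lie_one (Y : VField) : lie Y 1 = 0 := by simpa using lie_C Y 1

theorem lie_X (Y : VField) (i : Fin 3) : lie Y (X i) = Y i := by
  rw [lie, Finset.sum_eq_single i]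
  · simp
  · intro j _ hj
    simp [pderiv_X_of_ne hj.symm]
  · simp

theorem isPushforward_iff {Φ : FMap} {Y Z : VField} :
    IsPushforward Φ Y Z ↔ ∀ i, lie Y (Φ i) = pull Φ (Z i) := by
  simp only [IsPushforward, lie, mul_comm]

theorem lie_pull {Φ : FMap} (hΦ : ∀ i, OrdGE 1 (Φ i)) {Y Z : VField} (h : IsPushforward Φ Y Z)
    (f : Series) : lie Y (pull Φ f) = pull Φ (lie Z f) := by
  rw [isPushforward_iff] at h
  rw [lie, lie, pull_sum hΦ]
  simp only [pull_mul hΦ, ← h, pd_pull hΦ, lie, Finset.mul_sum, Finset.sum_mul]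
  rw [Finset.sum_comm]
  refine Finset.sum_congr rfl fun i _ => Finset.sum_congr rfl fun j _ => ?_
  ring

theorem IsPushforward.comp {Φ Ψ : FMap} (hΦ : ∀ i, OrdGE 1 (Φ i)) (hΨ : ∀ i, OrdGE 1 (Ψ i))
    {Y Z W : VField} (h : IsPushforward Φ Y Z) (h' : IsPushforward Ψ Z W) :
    IsPushforward (comp Ψ Φ) Y W := by
  rw [isPushforward_iff] at h' ⊢
  intro i
  rw [SaddleNode.comp, lie_pull hΦ h, h', pull_comp hΦ hΨ]

theorem IsPushforward.inverse {Φ Ψ : FMap} (hΦ : IsDiffeo Φ) (hΨ : IsDiffeo Ψ)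
    (h1 : SaddleNode.comp Ψ Φ = X) {Y Z : VField} (h : IsPushforward Φ Y Z) :
    IsPushforward Ψ Z Y := by
  rw [isPushforward_iff]
  intro i
  apply pull_injective hΦ
  rw [← lie_pull hΦ.ordGE h, ← pull_comp hΦ.ordGE hΨ.ordGE, h1, pull_X_self]
  have : pull Φ (Ψ i) = X i := congrFun h1 i
  rw [this, lie_X]

theorem exists_isPushforward {Φ : FMap} (hΦ : IsDiffeo Φ) (Y : VField) :
    ∃ Z, IsPushforward Φ Y Z := by
  obtain ⟨Ψ, h1, -, h2⟩ := hΦ.exists_inverse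
  refine ⟨fun i => pull Ψ (lie Y (Φ i)), isPushforward_iff.2 fun i => ?_⟩
  rw [← pull_comp hΦ.ordGE h1.ordGE, h2, pull_X_self]

/-! ### Fibered maps, Jacobian and divergence -/

/-- The Jacobian determinant along the fibers of `x`. -/
def jac (Φ : FMap) : Series := pd 1 (Φ 1) * pd 2 (Φ 2) - pd 2 (Φ 1) * pd 1 (Φ 2)

/-- The divergence along the fibers of `x`. -/
def fdiv (Y : VField) : Series := pd 1 (Y 1) + pd 2 (Y 2)

theorem pd_X_zero_of_ne {i : Fin 3} (hi : i ≠ 0) : pd i (X 0 : Series) = 0 :=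
  pderiv_X_of_ne hi.symm

/-- Since `Φ` preserves `x`, the `x`-derivatives of `Ψ` drop out of the fibre derivatives. -/
theorem jac_comp {Φ Ψ : FMap} (hΦ : ∀ i, OrdGE 1 (Φ i)) (h0 : Φ 0 = X 0) :
    jac (comp Ψ Φ) = pull Φ (jac Ψ) * jac Φ := by
  simp only [jac, comp, pd_pull hΦ, Fin.sum_univ_three, h0, pull_sub hΦ, pull_mul hΦ]
  rw [pd_X_zero_of_ne one_ne_zero, pd_X_zero_of_ne (by decide)]
  ring

theorem jac_X : jac (X : FMap) = 1 := by simp [jac]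

theorem constantCoeff_jac {Φ : FMap} (h0 : Φ 0 = X 0) :
    (Matrix.of fun i j : Fin 3 => constantCoeff (pd j (Φ i))).det = constantCoeff (jac Φ) := by
  rw [Matrix.det_fin_three]
  simp [h0, jac]

theorem isFibered_iff {Φ : FMap} : IsFibered Φ ↔
    (∀ i, OrdGE 1 (Φ i)) ∧ constantCoeff (jac Φ) ≠ 0 ∧ Φ 0 = X 0 := by
  constructor
  · rintro ⟨h, h0⟩
    have := h.jac
    rw [constantCoeff_jac h0, isUnit_iff_ne_zero] at this
    exact ⟨h.ordGE, this, h0⟩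
  · rintro ⟨h, hj, h0⟩
    refine ⟨⟨fun i => ordGE_one_iff.1 (h i), ?_⟩, h0⟩
    rwa [constantCoeff_jac h0, isUnit_iff_ne_zero]

theorem IsFibered.ordGE {Φ : FMap} (hΦ : IsFibered Φ) (i : Fin 3) : OrdGE 1 (Φ i) :=
  hΦ.diffeo.ordGE i

theorem IsFibered.comp {Φ Ψ : FMap} (hΨ : IsFibered Ψ) (hΦ : IsFibered Φ) :
    IsFibered (comp Ψ Φ) where
  diffeo := hΨ.diffeo.comp hΦ.diffeo
  fib := by rw [SaddleNode.comp, hΨ.fib, pull_X hΦ.ordGE, hΦ.fib]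

theorem IsFibered.exists_inverse {Φ : FMap} (hΦ : IsFibered Φ) :
    ∃ Ψ : FMap, IsFibered Ψ ∧ SaddleNode.comp Φ Ψ = X ∧ SaddleNode.comp Ψ Φ = X := by
  obtain ⟨Ψ, h1, h2, h3⟩ := hΦ.diffeo.exists_inverse
  refine ⟨Ψ, ⟨h1, ?_⟩, h2, h3⟩
  have := congrFun h2 0
  rwa [SaddleNode.comp, hΦ.fib, pull_X h1.ordGE] at this

/-- Modulo `dx`, a 2-form retains only its `(∂₁, ∂₂)` component, which for the pull-back is the
fibre Jacobian. -/
theorem isTransSymplectic_iff {Φ : FMap} : IsTransSymplectic Φ ↔ IsFibered Φ ∧ jac Φ = 1 := by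
  have hpull : ∀ (Φ : FMap), (∀ i, OrdGE 1 (Φ i)) → ∀ i j, pull2 Φ dy₁dy₂ i j =
      pd i (Φ 1) * pd j (Φ 2) - pd i (Φ 2) * pd j (Φ 1) := by
    intro Φ hΦ i j
    simp [pull2, dy₁dy₂, wedge, diff, Fin.sum_univ_three, pull_zero, pull_one, pull_neg hΦ]
    ring
  have hdx : ∀ i, dx i = if i = 0 then 1 else 0 := by
    intro i
    fin_cases i <;> simp [dx, diff]
  have hdy : ∀ i j, dy₁dy₂ i j = pd i (X 1 : Series) * pd j (X 2 : Series) -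
      pd j (X 1 : Series) * pd i (X 2 : Series) := fun i j => rfl
  constructor
  · rintro ⟨h1, h2, α, hα⟩
    rw [pull_X h1.ordGE] at h2
    refine ⟨⟨h1, h2⟩, ?_⟩
    have := congrFun (congrFun hα 1) 2
    rw [Matrix.sub_apply, hpull Φ h1.ordGE] at this
    simp [wedge, hdx, hdy] at this
    rw [jac]
    linear_combination this
  · rintro ⟨h, hj⟩
    refine ⟨h.diffeo, by rw [pull_X h.ordGE, h.fib], ?_⟩
    -- A 2-form `η` without `(∂₁, ∂₂)` component equals `dx ∧ η(∂ₓ, ·)`.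
    refine ⟨fun j => pull2 Φ dy₁dy₂ 0 j, ?_⟩
    rw [jac] at hj
    ext1 i j
    rw [Matrix.sub_apply, hpull Φ h.ordGE]
    simp only [wedge, hdx, hdy, Matrix.of_apply, hpull Φ h.ordGE]
    fin_cases i <;> fin_cases j <;> simp
    all_goals first | ring1 | linear_combination hj | linear_combination -hj

theorem IsTransSymplectic.comp {Φ Ψ : FMap} (hΨ : IsTransSymplectic Ψ) (hΦ : IsTransSymplectic Φ) :
    IsTransSymplectic (comp Ψ Φ) := by
  rw [isTransSymplectic_iff] at *
  refine ⟨hΨ.1.comp hΦ.1, ?_⟩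
  rw [jac_comp hΦ.1.ordGE hΦ.1.fib, hΨ.2, hΦ.2, pull_one, one_mul]

theorem IsTransSymplectic.exists_inverse {Φ : FMap} (hΦ : IsTransSymplectic Φ) :
    ∃ Ψ : FMap, IsTransSymplectic Ψ ∧ SaddleNode.comp Φ Ψ = X ∧ SaddleNode.comp Ψ Φ = X := by
  rw [isTransSymplectic_iff] at hΦ
  obtain ⟨Ψ, h1, h2, h3⟩ := hΦ.1.exists_inverse
  refine ⟨Ψ, isTransSymplectic_iff.2 ⟨h1, ?_⟩, h2, h3⟩
  have := jac_comp (Ψ := Φ) h1.ordGE h1.fib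
  rwa [h2, jac_X, hΦ.2, pull_one, one_mul, eq_comm] at this

theorem pd_comm (i j : Fin 3) (f : Series) : pd i (pd j f) = pd j (pd i f) := by
  ext d
  simp only [coeff_pderiv]
  by_cases h : i = j
  · subst h; rfl
  · rw [add_right_comm]
    simp [h, Ne.symm h]
    ring

/-- Liouville's formula: differentiate `Y(φᵢ) = Zᵢ ∘ Φ` along the fibres. As `Y 0` does not depend
on `y`, no `x`-derivative of `Φ` arises from differentiating it. -/
theorem pull_fdiv_mul_jac {Φ : FMap} (hΦ : ∀ i, OrdGE 1 (Φ i)) (h0 : Φ 0 = X 0) {Y Z : VField}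
    (h : IsPushforward Φ Y Z) (hY1 : pd 1 (Y 0) = 0) (hY2 : pd 2 (Y 0) = 0) :
    pull Φ (fdiv Z) * jac Φ = jac Φ * fdiv Y + lie Y (jac Φ) := by
  rw [isPushforward_iff] at h
  have key : ∀ i k, k ≠ 0 → pd k (lie Y (Φ i)) =
      pull Φ (pd 1 (Z i)) * pd k (Φ 1) + pull Φ (pd 2 (Z i)) * pd k (Φ 2) := by
    intro i k hk
    rw [h, pd_pull hΦ, Fin.sum_univ_three, h0, pd_X_zero_of_ne hk]
    ring
  have e11 := key 1 1 (by decide)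
  have e12 := key 1 2 (by decide)
  have e21 := key 2 1 (by decide)
  have e22 := key 2 2 (by decide)
  simp only [lie_eq, map_add, Derivation.leibniz, smul_eq_mul, hY1, hY2] at e11 e12 e21 e22
  simp only [jac, fdiv, lie_eq, map_sub, pull_add hΦ, Derivation.leibniz, smul_eq_mul]
  simp only [pd_comm 1 0, pd_comm 2 0, pd_comm 2 1] at e11 e12 e21 e22 ⊢
  -- The multipliers are, up to sign, the cofactors of the fibre Jacobian matrix.
  linear_combination (-pd 2 (Φ 2)) * e11 + pd 1 (Φ 2) * e12 + pd 2 (Φ 1) * e21 - pd 1 (Φ 1) * e22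

/-- The `(∂₁, ∂₂)` component of the defining relation reads `0 = x·fdiv Y - x²`; the second term
comes from the pole of `ω`. -/
theorem IsTransHamiltonian.fdiv_eq {Y : VField} (hY : IsTransHamiltonian Y)
    (h0 : Y 0 = X 0 ^ 2) : fdiv Y = X 0 := by
  obtain ⟨η, h1, α, rfl⟩ := hY.lie_omega
  have := congrFun (congrFun h1 1) 2
  simp [wedge, dx, dy₁dy₂, diff, lie2, lie_X, h0, Fin.sum_univ_three, lie_one] at this
  apply mul_left_cancel₀ (X_ne_zero 0)
  rw [fdiv]
  linear_combination -this

/-! ### The torus action -/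

theorem coeff_X_mul_eq_zero {i : Fin 3} {d : Fin 3 →₀ ℕ} (hd : d i = 0) (f : Series) :
    coeff d (X i * f) = 0 := X_dvd_iff.1 (dvd_mul_right _ _) d hd

theorem coeff_add_single_X_mul (i : Fin 3) (d : Fin 3 →₀ ℕ) (f : Series) :
    coeff (d + Finsupp.single i 1) (X i * f) = coeff d f := by
  rw [add_comm, X, coeff_add_monomial_mul, one_mul]

theorem exists_eq_add_single {i : Fin 3} {d : Fin 3 →₀ ℕ} (hd : d i ≠ 0) :
    ∃ e, d = e + Finsupp.single i 1 :=
  ⟨d - Finsupp.single i 1, (tsub_add_cancel_of_le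
    (Finsupp.single_le_iff.2 (Nat.one_le_iff_ne_zero.2 hd))).symm⟩

theorem coeff_X_mul_pd (i : Fin 3) (d : Fin 3 →₀ ℕ) (f : Series) :
    coeff d (X i * pd i f) = d i * coeff d f := by
  by_cases hd : d i = 0
  · rw [coeff_X_mul_eq_zero hd, hd]; simp
  · obtain ⟨e, rfl⟩ := exists_eq_add_single hd
    rw [coeff_add_single_X_mul, coeff_pderiv]
    simp [mul_comm]

/-- The generator `y₁ ∂_{y₁} - y₂ ∂_{y₂}` of the torus action. -/
def torus : VField := ![0, X 1, -X 2]

theorem lie_torus (f : Series) : lie torus f = X 1 * pd 1 f - X 2 * pd 2 f := by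
  simp [lie_eq, torus]; ring

theorem coeff_lie_torus (d : Fin 3 →₀ ℕ) (f : Series) :
    coeff d (lie torus f) = ((d 1 : ℂ) - d 2) * coeff d f := by
  rw [lie_torus, map_sub, coeff_X_mul_pd, coeff_X_mul_pd]; ring

theorem lie_torus_eq_iff {κ : ℂ} {f : Series} :
    lie torus f = C κ * f ↔ ∀ d : Fin 3 →₀ ℕ, (d 1 : ℂ) - d 2 ≠ κ → coeff d f = 0 := by
  rw [MvPowerSeries.ext_iff]
  refine forall_congr' fun d => ?_
  rw [coeff_lie_torus, coeff_C_mul, ← sub_eq_zero, ← sub_mul, mul_eq_zero, sub_eq_zero]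
  tauto

/-- Vector fields which are invariant under the torus action. -/
structure IsResonant (Y : VField) : Prop where
  zero : lie torus (Y 0) = 0
  one : lie torus (Y 1) = Y 1
  two : lie torus (Y 2) = -Y 2

/-- The three conditions are the components of `[torus, Y] = 0`. -/
theorem IsResonant.lie_comm {Y : VField} (hY : IsResonant Y) (f : Series) :
    lie torus (lie Y f) = lie Y (lie torus f) := by
  have h0 := hY.zero
  have h1 := hY.one
  have h2 := hY.two
  simp only [lie_torus] at h0 h1 h2 ⊢
  simp only [lie_eq, map_add, map_sub, Derivation.leibniz, smul_eq_mul, pderiv_X_self,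
    pderiv_X_of_ne (show (1 : Fin 3) ≠ 0 by decide), pderiv_X_of_ne (show (1 : Fin 3) ≠ 2 by decide),
    pderiv_X_of_ne (show (2 : Fin 3) ≠ 0 by decide), pderiv_X_of_ne (show (2 : Fin 3) ≠ 1 by decide)]
  simp only [pd_comm 1 0, pd_comm 2 0, pd_comm 2 1]
  linear_combination pd 0 f * h0 + pd 1 f * h1 + pd 2 f * h2

theorem IsResonant.lie_torus_fdiv {Y : VField} (hY : IsResonant Y) : lie torus (fdiv Y) = 0 := by
  have h1 := congrArg (pd 1) hY.one
  have h2 := congrArg (pd 2) hY.two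
  simp only [lie_torus, fdiv, map_add, map_sub, map_neg, Derivation.leibniz, smul_eq_mul,
    pderiv_X_self, pderiv_X_of_ne (show (1 : Fin 3) ≠ 2 by decide),
    pderiv_X_of_ne (show (2 : Fin 3) ≠ 1 by decide)] at h1 h2 ⊢
  simp only [pd_comm 2 1] at h1 h2 ⊢
  linear_combination h1 + h2

/-- The linear part of the vector field is `-λ y₁ ∂_{y₁} + λ y₂ ∂_{y₂}`. -/
structure HasLinearPart (lam : ℂ) (Y : VField) : Prop where
  zero : OrdGE 2 (Y 0)
  one : OrdGE 2 (Y 1 + C lam * X 1)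
  two : OrdGE 2 (Y 2 - C lam * X 2)

/-- After adding `λ·torus`, all components of the field have order 2, so it raises the order of a
series by one. -/
theorem HasLinearPart.ordGE_lie_add {lam : ℂ} {Y : VField} (hY : HasLinearPart lam Y) {n : ℕ}
    {f : Series} (hf : OrdGE n f) : OrdGE (n + 1) (lie Y f + C lam * lie torus f) := by
  have : lie Y f + C lam * lie torus f = Y 0 * pd 0 f + (Y 1 + C lam * X 1) * pd 1 f +
      (Y 2 - C lam * X 2) * pd 2 f := by
    rw [lie_eq, lie_torus]; ring
  rw [this]
  rcases n with _ | n
  · exact (((hY.zero.mul_right _).add (hY.one.mul_right _)).add (hY.two.mul_right _)).mono (by omega)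
  · exact (((hY.zero.mul (hf.pderiv 0)).add (hY.one.mul (hf.pderiv 1))).add
      (hY.two.mul (hf.pderiv 2))).mono (by omega)

/-- Induction on the order: in the lowest degree `Y` acts as `-λ·torus`, so the coefficient at `d`
is killed by `λ(d₁ - d₂ - κ)`, which is nonzero off weight `κ`. -/
theorem HasLinearPart.eq_zero_of_lie_eq {lam : ℂ} (hlam : lam ≠ 0) {Y : VField}
    (hY : HasLinearPart lam Y) {κ : ℂ} {r K : Series} (hr : constantCoeff r = 0)
    (hK : lie Y K = (r - C (lam * κ)) * K)
    (h : ∀ d : Fin 3 →₀ ℕ, (d 1 : ℂ) - d 2 = κ → coeff d K = 0) : K = 0 := by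
  refine eq_zero_of_forall_ordGE fun n => ?_
  induction n with
  | zero => exact .of_zero
  | succ n ih =>
    intro d hd
    by_cases hκ : (d 1 : ℂ) - d 2 = κ
    · exact h d hκ
    have h1 := hY.ordGE_lie_add ih d hd
    have h2 := ((ordGE_one_iff.2 hr).mul ih).mono (by omega : n + 1 ≤ 1 + n) d hd
    have h3 : lie Y K + C lam * lie torus K = r * K - C (lam * κ) * K + C lam * lie torus K := by
      rw [hK]; ring
    rw [h3, map_add, map_sub, h2, coeff_C_mul, coeff_C_mul, coeff_lie_torus] at h1
    have h4 : lam * (((d 1 : ℂ) - d 2) - κ) * coeff d K = 0 := by linear_combination h1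
    simpa [hlam, sub_eq_zero, hκ] using h4

/-- `torus(K) - κK` solves the same equation, because the torus commutes with `Y` and kills `r`, and
it has no coefficient of weight `κ`. -/
theorem HasLinearPart.lie_torus_eq {lam : ℂ} (hlam : lam ≠ 0) {Y : VField}
    (hY : HasLinearPart lam Y) (hres : IsResonant Y) {κ : ℂ} {r K : Series}
    (hr : constantCoeff r = 0) (hr' : lie torus r = 0) (hK : lie Y K = (r - C (lam * κ)) * K) :
    lie torus K = C κ * K := by
  rw [← sub_eq_zero]
  refine hY.eq_zero_of_lie_eq hlam (κ := κ) hr ?_ fun d hd => ?_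
  · rw [lie_sub, ← hres.lie_comm, hK, lie_mul, lie_mul, lie_sub, hr', lie_C, lie_C, hK]
    ring
  · rw [map_sub, coeff_lie_torus, coeff_C_mul, hd, sub_self]

/-- `y₁ y₂ jac = y₂ ∂_{y₂}(φ₁ φ₂)` for torus-equivariant maps. -/
theorem mul_jac_of_lie_torus {Φ : FMap} (h1 : lie torus (Φ 1) = Φ 1)
    (h2 : lie torus (Φ 2) = -Φ 2) :
    X 1 * X 2 * jac Φ = X 2 * pd 2 (Φ 1 * Φ 2) := by
  rw [lie_torus] at h1 h2
  simp only [jac, Derivation.leibniz, smul_eq_mul]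
  linear_combination X 2 * pd 2 (Φ 2) * h1 - X 2 * pd 2 (Φ 1) * h2

/-! ### The residue -/

theorem IsPrepared.hasLinearPart {lam : ℂ} {Z : VField} (hZ : IsPrepared lam Z) :
    Z 0 = X 0 ^ 2 ∧ HasLinearPart lam Z := by
  obtain ⟨F₁, F₂, h1, h2, rfl⟩ := hZ
  refine ⟨rfl, ?_, ?_, ?_⟩
  · rw [pow_two]; exact (OrdGE.X 0).mul (OrdGE.X 0)
  · have : OrdGE 2 F₁ := ordGE_iff_le_order.2 h1
    simpa using this
  · have : OrdGE 2 F₂ := ordGE_iff_le_order.2 h2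
    simpa using this

theorem HasLinearPart.constantCoeff_fdiv {lam : ℂ} {Z : VField} (hZ : HasLinearPart lam Z) :
    constantCoeff (fdiv Z) = 0 := by
  have h1 := ordGE_one_iff.1 (hZ.one.pderiv 1)
  have h2 := ordGE_one_iff.1 (hZ.two.pderiv 2)
  simp [Derivation.leibniz] at h1 h2
  rw [fdiv, map_add]
  linear_combination h1 + h2

/-- Transported to `Z`, the Jacobian `K` satisfies `fdiv Z · K = xK + Z(K)`. The monomial `x` has
torus weight 0, so `Z(K)` has no `x`-coefficient; as `fdiv Z` vanishes at 0, comparison leaves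
`r·K(0) = K(0)`. -/
theorem eq_one_of_hasResidue {Y : VField} (h0 : Y 0 = X 0 ^ 2) (hdiv : fdiv Y = X 0) {r : ℂ}
    (h : HasResidue Y r) : r = 1 := by
  obtain ⟨lam, Φ, Z, -, hΦ, hYZ, hZ, rfl⟩ := h
  obtain ⟨-, hZ⟩ := hZ.hasLinearPart
  have hd := pull_fdiv_mul_jac hΦ.ordGE hΦ.fib hYZ (by simp [h0])
    (by simp [h0])
  obtain ⟨Ψ, hΨ, -, h2⟩ := hΦ.exists_inverse
  have hJ : pull Φ (pull Ψ (jac Φ)) = jac Φ := by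
    rw [← pull_comp hΦ.ordGE hΨ.ordGE, h2, pull_X_self]
  set K := pull Ψ (jac Φ) with hK
  have hX : pull Φ (X 0) = X 0 := by rw [pull_X hΦ.ordGE, hΦ.fib]
  have hZK : fdiv Z * K = X 0 * K + lie Z K := by
    apply pull_injective hΦ.diffeo
    rw [pull_mul hΦ.ordGE, pull_add hΦ.ordGE, pull_mul hΦ.ordGE, ← lie_pull hΦ.ordGE hYZ, hJ, hX,
      hd, hdiv]
    ring
  have hK0 : constantCoeff K ≠ 0 := by
    rw [hK, constantCoeff_pull hΨ.ordGE]
    exact (isFibered_iff.1 hΦ).2.1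
  have h4 : OrdGE 2 (lie Z K + C lam * lie torus K) := by
    have h5 := hZ.ordGE_lie_add (n := 1) (f := K - C (constantCoeff K)) (ordGE_one_iff.2 (by simp))
    simpa [lie_sub, lie_C] using h5
  have h5 : coeff (Finsupp.single 0 1) (lie Z K) = 0 := by
    have := h4 (Finsupp.single 0 1) (by simp)
    rw [map_add, coeff_C_mul, coeff_lie_torus] at this
    simpa using this
  have h6 := congrArg (coeff (Finsupp.single 0 1)) hZK
  rw [map_add, h5, coeff_single_eq_constantCoeff_pd, coeff_single_eq_constantCoeff_pd] at h6
  simp only [Derivation.leibniz, smul_eq_mul, map_add, map_mul, hZ.constantCoeff_fdiv] at h6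
  simp at h6
  rw [preparedResidue, coeff_single_eq_constantCoeff_pd]
  apply mul_left_cancel₀ hK0
  rw [mul_one]
  exact h6

/-! ### Series in `v = y₁ y₂` and normal forms -/

theorem ordGE_v : OrdGE 1 (X 1 * X 2 : Series) := (OrdGE.X 1).mul_right _

/-- The cofactor is `c'(w)`, but its value is irrelevant: the lemma serves when `Y` kills `w`. -/
theorem lie_subst (Y : VField) {w : Series} (hw : OrdGE 1 w) (c : PowerSeries ℂ) :
    ∃ g : Series, lie Y (PowerSeries.subst w c) = g * lie Y w := by
  refine ⟨PowerSeries.subst w (pderiv ℂ () c), ?_⟩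
  have h := fun i : Fin 3 => pderiv_subst (a := fun _ : Unit => w) (fun _ => hw) i c
  simp only [lie_eq, PowerSeries.subst]
  rw [pd, pd, pd, h, h, h]
  simp
  ring

theorem pull_ofV {Φ : FMap} (hΦ : ∀ i, OrdGE 1 (Φ i)) (c : PowerSeries ℂ) :
    pull Φ (ofV c) = PowerSeries.subst (Φ 1 * Φ 2) c := by
  have h1 : HasSubst (fun _ : Unit => (X 1 * X 2 : Series)) := hasSubst_of_ordGE fun _ => ordGE_v
  have := subst_comp_subst_apply (R := ℂ) h1 (hasSubst_of_ordGE hΦ) c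
  simp only [pull, ofV, PowerSeries.subst]
  rw [this]
  congr 1
  funext _
  have := pull_mul hΦ (X 1) (X 2)
  rwa [pull_X hΦ, pull_X hΦ] at this

theorem constantCoeff_powerSeries_subst {w : Series} (hw : OrdGE 1 w) {c : PowerSeries ℂ}
    (hc : PowerSeries.constantCoeff c = 0) : constantCoeff (PowerSeries.subst w c) = 0 :=
  PowerSeries.constantCoeff_subst_eq_zero (ordGE_one_iff.1 hw) c hc

theorem lie_torus_v : lie torus (X 1 * X 2) = 0 := by
  rw [lie_mul, lie_X, lie_X]; simp [torus]; ring

theorem lie_torus_ofV (c : PowerSeries ℂ) : lie torus (ofV c) = 0 := by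
  obtain ⟨g, hg⟩ := lie_subst torus ordGE_v c
  rw [ofV, hg, lie_torus_v, mul_zero]

theorem coeff_ofV (c : PowerSeries ℂ) (d : Fin 3 →₀ ℕ) :
    coeff d (ofV c) = if d 0 = 0 ∧ d 1 = d 2 then PowerSeries.coeff (d 1) c else 0 := by
  have hv : ∀ n : ℕ, (X 1 * X 2 : Series) ^ n =
      monomial (Finsupp.single 1 n + Finsupp.single 2 n) 1 := by
    intro n
    rw [mul_pow, X_pow_eq, X_pow_eq, monomial_mul_monomial, one_mul]
  rw [ofV, PowerSeries.coeff_subst (PowerSeries.HasSubst.of_constantCoeff_zero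
    (ordGE_one_iff.1 ordGE_v))]
  simp only [hv, coeff_monomial]
  have hiff : ∀ n : ℕ, d = Finsupp.single 1 n + Finsupp.single 2 n ↔
      (d 0 = 0 ∧ d 1 = d 2) ∧ n = d 1 := by
    intro n
    rw [Finsupp.ext_iff]
    simp [Fin.forall_fin_succ]
    omega
  split_ifs with h
  · rw [finsum_eq_single _ (d 1)]
    · rw [if_pos ((hiff _).2 ⟨h, rfl⟩)]; simp
    · intro n hn
      rw [if_neg (fun h' => hn ((hiff n).1 h').2)]; simp
  · refine finsum_eq_zero_of_forall_eq_zero fun n => ?_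
    rw [if_neg (fun h' => h ((hiff n).1 h').1)]; simp

theorem normalForm_isPrepared (lam a₁ a₂ : ℂ) {c : PowerSeries ℂ}
    (hc : PowerSeries.constantCoeff c = 0) : IsPrepared lam (normalForm lam a₁ a₂ c) := by
  have hc1 : OrdGE 1 (ofV c) := ordGE_one_iff.2 (constantCoeff_powerSeries_subst ordGE_v hc)
  refine ⟨(C a₁ * X 0 - ofV c) * X 1, (C a₂ * X 0 + ofV c) * X 2, ?_, ?_, ?_⟩
  · exact ordGE_iff_le_order.1 ((((OrdGE.X 0).mul_left _).sub hc1).mul (OrdGE.X 1))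
  · exact ordGE_iff_le_order.1 ((((OrdGE.X 0).mul_left _).add hc1).mul (OrdGE.X 2))
  · rw [normalForm]
    congr 2
    · ring
    · congr 1
      ring

theorem normalForm_isResonant (lam a₁ a₂ : ℂ) (c : PowerSeries ℂ) :
    IsResonant (normalForm lam a₁ a₂ c) := by
  have h0 : lie torus (X 0) = 0 := lie_X torus 0
  have h1 : lie torus (X 1) = X 1 := lie_X torus 1
  have h2 : lie torus (X 2) = -X 2 := lie_X torus 2
  constructor
  · simp [normalForm, pow_two, lie_mul, h0]
  · simp [normalForm, lie_mul, lie_sub, lie_add, ← map_neg, lie_C, h0, h1, lie_torus_ofV]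
  · simp [normalForm, lie_mul, lie_add, lie_C, h0, h2, lie_torus_ofV]

/-! ### Uniqueness -/

/-- The right-hand side is grouped in the shape that `HasLinearPart.lie_torus_eq` expects. -/
theorem lie_normalForm_one {Φ : FMap} (hΦ : IsFibered Φ) {N : VField} {mu b₁ b₂ : ℂ}
    {d : PowerSeries ℂ} (h : IsPushforward Φ N (normalForm mu b₁ b₂ d)) :
    lie N (Φ 1) = ((C b₁ * X 0 - PowerSeries.subst (Φ 1 * Φ 2) d) - C mu) * Φ 1 := by
  rw [isPushforward_iff.1 h, normalForm]
  simp only [Matrix.cons_val_one, Matrix.cons_val_zero, pull_mul hΦ.ordGE, pull_sub hΦ.ordGE,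
    pull_add hΦ.ordGE, pull_neg hΦ.ordGE, pull_C, pull_X hΦ.ordGE, pull_ofV hΦ.ordGE, hΦ.fib]
  ring

theorem lie_normalForm_two {Φ : FMap} (hΦ : IsFibered Φ) {N : VField} {mu b₁ b₂ : ℂ}
    {d : PowerSeries ℂ} (h : IsPushforward Φ N (normalForm mu b₁ b₂ d)) :
    lie N (Φ 2) = ((C b₂ * X 0 + PowerSeries.subst (Φ 1 * Φ 2) d) + C mu) * Φ 2 := by
  rw [isPushforward_iff.1 h, normalForm]
  simp only [Matrix.cons_val, pull_mul hΦ.ordGE,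
    pull_add hΦ.ordGE, pull_C, pull_X hΦ.ordGE, pull_ofV hΦ.ordGE, hΦ.fib]
  ring

theorem ordGE_mul_one_two {Φ : FMap} (hΦ : IsFibered Φ) : OrdGE 1 (Φ 1 * Φ 2) :=
  (hΦ.ordGE 1).mul_right _

/-- In degree one the equation for `φ₁` multiplies its `y₁`-coefficient by `μ - λ` and its
`y₂`-coefficient by `μ + λ`. If neither factor is zero, both coefficients vanish, contradicting
invertibility. -/
theorem eigenvalue_eq_or_eq_neg {lam : ℂ} {N : VField} (hN : HasLinearPart lam N) {Φ : FMap}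
    (hΦ : IsFibered Φ) {mu b₁ b₂ : ℂ} {d : PowerSeries ℂ} (hd : PowerSeries.constantCoeff d = 0)
    (h : IsPushforward Φ N (normalForm mu b₁ b₂ d)) : mu = lam ∨ mu = -lam := by
  by_contra! hne
  have hd' := constantCoeff_powerSeries_subst (ordGE_mul_one_two hΦ) hd
  have hcoeff : ∀ i : Fin 3, i ≠ 0 → coeff (Finsupp.single i 1) (Φ 1) = 0 := by
    intro i hi
    have h1 := hN.ordGE_lie_add (hΦ.ordGE 1) (Finsupp.single i 1) (by simp)
    rw [lie_normalForm_one hΦ h, sub_mul, map_add, map_sub, coeff_C_mul, coeff_C_mul,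
      coeff_lie_torus] at h1
    have h2 : OrdGE 2 ((C b₁ * X 0 - PowerSeries.subst (Φ 1 * Φ 2) d) * Φ 1) :=
      (((OrdGE.X 0).mul_left _).sub (ordGE_one_iff.2 hd')).mul (hΦ.ordGE 1)
    rw [h2 _ (by simp)] at h1
    fin_cases i
    · exact absurd rfl hi
    · simp at h1 ⊢
      have : (mu - lam) * coeff (Finsupp.single 1 1) (Φ 1) = 0 := by linear_combination -h1
      simpa [sub_eq_zero, hne.1] using this
    · simp at h1 ⊢
      have : (mu - -lam) * coeff (Finsupp.single 2 1) (Φ 1) = 0 := by linear_combination -h1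
      rcases mul_eq_zero.1 this with h | h
      · exact absurd (sub_eq_zero.1 h) hne.2
      · exact h
  apply (isFibered_iff.1 hΦ).2.1
  rw [jac, map_sub, map_mul, map_mul, ← coeff_single_eq_constantCoeff_pd,
    ← coeff_single_eq_constantCoeff_pd 2 (Φ 1), hcoeff 1 (by decide), hcoeff 2 (by decide)]
  ring

theorem normalForm_unique {lam a₁ a₂ b₁ b₂ : ℂ} {c d : PowerSeries ℂ} (hlam : lam ≠ 0)
    (ha : a₁ + a₂ = 1) (hb : b₁ + b₂ = 1) (hc : PowerSeries.constantCoeff c = 0)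
    (hd : PowerSeries.constantCoeff d = 0) {Φ : FMap} (hΦ : IsTransSymplectic Φ)
    (h : IsPushforward Φ (normalForm lam a₁ a₂ c) (normalForm lam b₁ b₂ d)) :
    b₁ = a₁ ∧ b₂ = a₂ ∧ d = c := by
  obtain ⟨hΦ, hjac⟩ := isTransSymplectic_iff.1 hΦ
  have hlin := (normalForm_isPrepared lam a₁ a₂ hc).hasLinearPart.2
  have hres := normalForm_isResonant lam a₁ a₂ c
  have e1 := lie_normalForm_one hΦ h
  have e2 := lie_normalForm_two hΦ h
  have hv1 : lie torus (X 0) = 0 := lie_X torus 0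
  set N := normalForm lam a₁ a₂ c with hN
  set w := Φ 1 * Φ 2 with hw
  set W := PowerSeries.subst w d with hW
  have hW0 : constantCoeff W = 0 := constantCoeff_powerSeries_subst (ordGE_mul_one_two hΦ) hd
  have hCb : (C b₁ + C b₂ : Series) = 1 := by rw [← map_add, hb, map_one]
  have hCa : (C a₁ + C a₂ : Series) = 1 := by rw [← map_add, ha, map_one]
  have hNw : lie N w = X 0 * w := by
    rw [hw, lie_mul, e1, e2]
    linear_combination X 0 * Φ 1 * Φ 2 * hCb
  have hwt : lie torus w = 0 := by
    have := hlin.lie_torus_eq hlam hres (κ := 0) (r := X 0) (K := w) (by simp) hv1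
      (by rw [hNw]; simp)
    simpa using this
  have hWt : lie torus W = 0 := by
    obtain ⟨g, hg⟩ := lie_subst torus (ordGE_mul_one_two hΦ) d
    rw [hW, hg, hwt, mul_zero]
  have h1t : lie torus (Φ 1) = Φ 1 := by
    have := hlin.lie_torus_eq hlam hres (κ := 1) (r := C b₁ * X 0 - W) (K := Φ 1)
      (by simp [hW0]) (by rw [lie_sub, lie_mul, lie_C, hv1, hWt]; ring) (by rw [e1, mul_one])
    simpa using this
  have h2t : lie torus (Φ 2) = -Φ 2 := by
    have := hlin.lie_torus_eq hlam hres (κ := -1) (r := C b₂ * X 0 + W) (K := Φ 2)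
      (by simp [hW0]) (by rw [lie_add, lie_mul, lie_C, hv1, hWt]; ring)
      (by rw [e2, mul_neg_one, map_neg]; ring)
    simpa using this
  -- Equivariance turns Jacobian 1 into an Euler equation for `w`.
  have hE2 : X 2 * pd 2 w = X 1 * X 2 := by
    have := mul_jac_of_lie_torus h1t h2t
    rw [hjac, mul_one] at this
    exact this.symm
  have hE1 : X 1 * pd 1 w = X 1 * X 2 := by
    rw [lie_torus] at hwt
    linear_combination hwt + hE2
  have hN0 : N 0 = X 0 ^ 2 := rfl
  have hN1 : N 1 = (-C lam + C a₁ * X 0 - ofV c) * X 1 := rfl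
  have hN2 : N 2 = (C lam + C a₂ * X 0 + ofV c) * X 2 := rfl
  have hE0 : X 0 * pd 0 w + X 1 * X 2 = w := by
    apply mul_left_cancel₀ (X_ne_zero 0)
    rw [← hNw, lie_eq, hN0, hN1, hN2]
    linear_combination -(-C lam + C a₁ * X 0 - ofV c) * hE1 - (C lam + C a₂ * X 0 + ofV c) * hE2 -
      X 0 * X 1 * X 2 * hCa
  -- Coefficientwise, the three Euler equations confine `w - y₁y₂` to the monomial `x`, which is
  -- excluded since both series have order 2.
  have hwv : w = X 1 * X 2 := by
    rw [← sub_eq_zero]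
    ext d
    have k0 : (d 0 : ℂ) * coeff d w + coeff d (X 1 * X 2 : Series) = coeff d w := by
      rw [← coeff_X_mul_pd, ← map_add, hE0]
    have k1 : (d 1 : ℂ) * coeff d w = coeff d (X 1 * X 2 : Series) := by
      rw [← coeff_X_mul_pd, hE1]
    have k2 : (d 2 : ℂ) * coeff d w = coeff d (X 1 * X 2 : Series) := by
      rw [← coeff_X_mul_pd, hE2]
    have l0 : (d 0 : ℂ) * coeff d (X 1 * X 2 : Series) = 0 := by
      rw [← coeff_X_mul_pd]; simp [Derivation.leibniz]
    have l1 : (d 1 : ℂ) * coeff d (X 1 * X 2 : Series) = coeff d (X 1 * X 2 : Series) := by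
      rw [← coeff_X_mul_pd]; simp [Derivation.leibniz]
    have l2 : (d 2 : ℂ) * coeff d (X 1 * X 2 : Series) = coeff d (X 1 * X 2 : Series) := by
      rw [← coeff_X_mul_pd]; simp [Derivation.leibniz, mul_comm]
    rw [map_sub, map_zero]
    by_contra hne
    have m0 : (d 0 : ℂ) = 1 := by
      apply mul_right_cancel₀ hne; linear_combination k0 - l0
    have m1 : (d 1 : ℂ) = 0 := by
      apply mul_right_cancel₀ hne; linear_combination k1 - l1
    have m2 : (d 2 : ℂ) = 0 := by
      apply mul_right_cancel₀ hne; linear_combination k2 - l2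
    norm_cast at m0 m1 m2
    have hdeg : d.degree < 2 := by
      rw [Finsupp.degree_eq_sum, Fin.sum_univ_three]; omega
    apply hne
    rw [((hΦ.ordGE 1).mul (hΦ.ordGE 2)) d hdeg, ((OrdGE.X 1).mul (OrdGE.X 2)) d hdeg, sub_zero]
  have hWd : W = ofV d := by rw [hW, hwv, ofV]
  have hmain : (C a₁ * X 0 - ofV c - C b₁ * X 0 + ofV d) * Φ 1 =
      -(X 0 * (X 0 * pd 0 (Φ 1) + X 2 * pd 2 (Φ 1))) := by
    rw [lie_eq, hN0, hN1, hN2, hWd] at e1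
    rw [lie_torus] at h1t
    linear_combination e1 - (-C lam + C a₁ * X 0 - ofV c) * h1t -
      X 0 * X 2 * pd 2 (Φ 1) * hCa
  -- Multiplying by `φ₂` and using `φ₁φ₂ = v` turns the left side into a series in `v` plus
  -- multiples of `x`; at `x = 0` only `v(d(v) - c(v))` survives.
  have hdc : d = c := by
    ext k
    have h3 : X 1 * (X 2 * (ofV d - ofV c)) =
        X 0 * (Φ 2 * (-(X 0 * pd 0 (Φ 1) + X 2 * pd 2 (Φ 1)) - (C a₁ - C b₁) * Φ 1)) := by
      rw [← mul_assoc, ← hwv, hw]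
      linear_combination Φ 2 * hmain
    have h4 := congrArg (coeff (Finsupp.single 1 k + Finsupp.single 2 k + Finsupp.single 2 1 +
      Finsupp.single 1 1)) h3
    rw [coeff_add_single_X_mul, coeff_add_single_X_mul, coeff_X_mul_eq_zero (by simp), map_sub,
      coeff_ofV, coeff_ofV] at h4
    simpa [sub_eq_zero] using h4
  -- With `c = d` the factor `x` cancels. The operator `x∂ₓ + y₂∂₂` kills the monomial `y₁`, whose
  -- coefficient in `φ₁` is nonzero because the Jacobian is 1.
  have hab : b₁ = a₁ := by
    have h3 : (C (a₁ - b₁)) * Φ 1 = -(X 0 * pd 0 (Φ 1) + X 2 * pd 2 (Φ 1)) := by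
      apply mul_left_cancel₀ (X_ne_zero 0)
      rw [hdc] at hmain
      rw [map_sub]
      linear_combination hmain
    have h4 := congrArg (coeff (Finsupp.single 1 1)) h3
    rw [coeff_C_mul, map_neg, map_add, coeff_X_mul_pd, coeff_X_mul_pd] at h4
    have h5 : coeff (Finsupp.single 2 1) (Φ 1) = 0 := by
      have h1t' : lie torus (Φ 1) = C 1 * Φ 1 := by simpa using h1t
      refine lie_torus_eq_iff.1 h1t' _ ?_
      simp
      norm_num
    have h6 := congrArg constantCoeff hjac
    rw [jac, map_sub, map_mul, map_mul, ← coeff_single_eq_constantCoeff_pd 1 (Φ 1),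
      ← coeff_single_eq_constantCoeff_pd 2 (Φ 1), h5] at h6
    have h7 : coeff (Finsupp.single 1 1) (Φ 1) ≠ 0 := by
      intro h7
      simp [h7] at h6
    simp [h7, sub_eq_zero] at h4
    exact h4.symm
  refine ⟨hab, ?_, hdc⟩
  linear_combination hb - ha - hab

/-! ### The exchange of `y₁` and `y₂` -/

/-- The symplectic linear map `(x, y₁, y₂) ↦ (x, y₂, -y₁)`. -/
def swap : FMap := ![X 0, X 2, -X 1]

theorem swap_isTransSymplectic : IsTransSymplectic swap := by
  have hj : jac swap = 1 := by simp [jac, swap]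
  refine isTransSymplectic_iff.2 ⟨isFibered_iff.2 ⟨?_, by simp [hj], rfl⟩, hj⟩
  intro i
  fin_cases i
  · exact OrdGE.X 0
  · exact OrdGE.X 2
  · exact (OrdGE.X 1).neg

/-- The exchange sends `v` to `-v`; this is the origin of `-c(-v)`. -/
theorem pull_swap_ofV (c : PowerSeries ℂ) :
    pull swap (ofV (-(PowerSeries.rescale (-1) c))) = -ofV c := by
  have hs := (isTransSymplectic_iff.1 swap_isTransSymplectic).1
  have h1 : PowerSeries.HasSubst (swap 1 * swap 2) :=
    PowerSeries.HasSubst.of_constantCoeff_zero (ordGE_one_iff.1 (ordGE_mul_one_two hs))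
  rw [pull_ofV hs.ordGE, ← PowerSeries.coe_substAlgHom h1, map_neg, PowerSeries.coe_substAlgHom,
    PowerSeries.rescale_eq_subst, PowerSeries.subst_comp_subst_apply
    (PowerSeries.HasSubst.smul_X' (-1)) h1, PowerSeries.subst_smul h1, PowerSeries.subst_X h1, ofV]
  congr 2
  simp [swap, mul_comm]

theorem isPushforward_swap (lam a₁ a₂ : ℂ) (c : PowerSeries ℂ) :
    IsPushforward swap (normalForm lam a₁ a₂ c)
      (normalForm (-lam) a₂ a₁ (-(PowerSeries.rescale (-1) c))) := by
  have hs := (isTransSymplectic_iff.1 swap_isTransSymplectic).1.ordGE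
  have hv : pull swap (X 0) = X 0 := pull_X hs 0
  have hv1 : pull swap (X 1) = X 2 := pull_X hs 1
  have hv2 : pull swap (X 2) = -X 1 := pull_X hs 2
  rw [isPushforward_iff]
  intro i
  fin_cases i
  · change lie _ (X 0) = pull swap (X 0 ^ 2)
    rw [lie_X, pull_pow hs, hv]
    rfl
  · change lie _ (X 2) = pull swap ((-C (-lam) + C a₂ * X 0 - ofV _) * X 1)
    rw [lie_X, pull_mul hs, pull_sub hs, pull_add hs, pull_mul hs, pull_neg hs, pull_C, pull_C,
      pull_swap_ofV, hv, hv1, normalForm]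
    simp
  · change lie _ (-X 1) = pull swap ((C (-lam) + C a₁ * X 0 + ofV _) * X 2)
    have : lie (normalForm lam a₁ a₂ c) (-X 1) = -normalForm lam a₁ a₂ c 1 := by
      simp [lie_eq]
    rw [this, pull_mul hs, pull_add hs, pull_add hs, pull_mul hs, pull_C, pull_C,
      pull_swap_ofV, hv, hv2, normalForm, map_neg]
    simp only [Matrix.cons_val_one, Matrix.cons_val_zero]
    ring

theorem HasNormalForm.swap {Y : VField} {lam a₁ a₂ : ℂ} {c : PowerSeries ℂ}
    (h : HasNormalForm Y lam a₁ a₂ c) :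
    HasNormalForm Y (-lam) a₂ a₁ (-(PowerSeries.rescale (-1) c)) := by
  obtain ⟨h1, h2, h3, Φ, hΦ, hN⟩ := h
  refine ⟨neg_ne_zero.2 h1, by rw [add_comm, h2], ?_, comp SaddleNode.swap Φ,
    swap_isTransSymplectic.comp hΦ, hN.comp hΦ.diffeo.ordGE swap_isTransSymplectic.diffeo.ordGE
      (isPushforward_swap _ _ _ _)⟩
  rw [map_neg, neg_eq_zero, ← PowerSeries.coeff_zero_eq_constantCoeff_apply,
    PowerSeries.coeff_rescale, PowerSeries.coeff_zero_eq_constantCoeff_apply, h3, mul_zero]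

/-! ### Comparison of the normal forms of one vector field -/

theorem HasNormalForm.exists_isPushforward {Y : VField} {lam a₁ a₂ mu b₁ b₂ : ℂ}
    {c d : PowerSeries ℂ} (h : HasNormalForm Y lam a₁ a₂ c) (h' : HasNormalForm Y mu b₁ b₂ d) :
    ∃ Φ, IsTransSymplectic Φ ∧
      IsPushforward Φ (normalForm lam a₁ a₂ c) (normalForm mu b₁ b₂ d) := by
  obtain ⟨-, -, -, Φ, hΦ, hN⟩ := h
  obtain ⟨-, -, -, Φ', hΦ', hN'⟩ := h'
  obtain ⟨Ψ, hΨ, -, h2⟩ := hΦ.exists_inverse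
  exact ⟨comp Φ' Ψ, hΦ'.comp hΨ,
    (hN.inverse hΦ.diffeo hΨ.diffeo h2).comp hΨ.diffeo.ordGE hΦ'.diffeo.ordGE hN'⟩

theorem HasNormalForm.unique {Y : VField} {lam a₁ a₂ b₁ b₂ : ℂ}
    {c d : PowerSeries ℂ} (h : HasNormalForm Y lam a₁ a₂ c) (h' : HasNormalForm Y lam b₁ b₂ d) :
    b₁ = a₁ ∧ b₂ = a₂ ∧ d = c := by
  obtain ⟨Φ, hΦ, hN⟩ := h.exists_isPushforward h'
  exact normalForm_unique h.1 h.2.1 h'.2.1 h.2.2.1 h'.2.2.1 hΦ hN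

theorem hasNormalForm_iff {Y : VField} {lam a₁ a₂ : ℂ} {c : PowerSeries ℂ}
    (h : HasNormalForm Y lam a₁ a₂ c) (mu b₁ b₂ : ℂ) (d : PowerSeries ℂ) :
    HasNormalForm Y mu b₁ b₂ d ↔
      (mu = lam ∧ b₁ = a₁ ∧ b₂ = a₂ ∧ d = c) ∨
      (mu = -lam ∧ b₁ = a₂ ∧ b₂ = a₁ ∧ d = -(PowerSeries.rescale (-1) c)) := by
  constructor
  · intro h'
    obtain ⟨Φ, hΦ, hN⟩ := h.exists_isPushforward h'
    rcases eigenvalue_eq_or_eq_neg (normalForm_isPrepared lam a₁ a₂ h.2.2.1).hasLinearPart.2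
      (isTransSymplectic_iff.1 hΦ).1 h'.2.2.1 hN with rfl | rfl
    · exact Or.inl ⟨rfl, h.unique h'⟩
    · exact Or.inr ⟨rfl, h.swap.unique h'⟩
  · rintro (⟨rfl, rfl, rfl, rfl⟩ | ⟨rfl, rfl, rfl, rfl⟩)
    · exact h
    · exact h.swap

theorem hasResidue_iff {Y : VField} (h0 : Y 0 = X 0 ^ 2) (hdiv : fdiv Y = X 0) {lam a₁ a₂ : ℂ}
    {c : PowerSeries ℂ} (h : HasNormalForm Y lam a₁ a₂ c) (r : ℂ) :
    HasResidue Y r ↔ r = a₁ + a₂ := by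
  obtain ⟨h1, h2, h3, Φ, hΦ, hN⟩ := h
  rw [h2]
  refine ⟨eq_one_of_hasResidue h0 hdiv, ?_⟩
  rintro rfl
  -- The normal form is itself prepared, so some residue exists, and it can only be 1.
  have hr : HasResidue Y (preparedResidue (normalForm lam a₁ a₂ c)) :=
    ⟨lam, Φ, _, h1, (isTransSymplectic_iff.1 hΦ).1, hN, normalForm_isPrepared lam a₁ a₂ h3, rfl⟩
  rwa [eq_one_of_hasResidue h0 hdiv hr] at hr

/-! ### Elimination of the non-resonant terms -/

/-- The projection to the monomials of torus weight `κ`. -/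
def weightPart (κ : ℂ) (f : Series) : Series :=
  fun d => if (d 1 : ℂ) - d 2 = κ then coeff d f else 0

theorem coeff_weightPart (κ : ℂ) (f : Series) (d : Fin 3 →₀ ℕ) :
    coeff d (weightPart κ f) = if (d 1 : ℂ) - d 2 = κ then coeff d f else 0 := rfl

/-- The inverse of `λ (κ - torus)` on the monomials of torus weight different from `κ`. -/
def homologicalInv (lam κ : ℂ) (f : Series) : Series :=
  fun d => if (d 1 : ℂ) - d 2 = κ then 0 else coeff d f / (lam * (κ - ((d 1 : ℂ) - d 2)))

theorem coeff_homologicalInv (lam κ : ℂ) (f : Series) (d : Fin 3 →₀ ℕ) :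
    coeff d (homologicalInv lam κ f) =
      if (d 1 : ℂ) - d 2 = κ then 0 else coeff d f / (lam * (κ - ((d 1 : ℂ) - d 2))) := rfl

theorem lie_torus_weightPart (κ : ℂ) (f : Series) :
    lie torus (weightPart κ f) = C κ * weightPart κ f :=
  lie_torus_eq_iff.2 fun d hd => by rw [coeff_weightPart, if_neg hd]

theorem homologicalInv_spec {lam : ℂ} (hlam : lam ≠ 0) (κ : ℂ) (f : Series) :
    C lam * (C κ * homologicalInv lam κ f - lie torus (homologicalInv lam κ f)) =
      f - weightPart κ f := by
  ext d
  rw [coeff_C_mul, map_sub, coeff_C_mul, coeff_lie_torus, map_sub, coeff_weightPart,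
    coeff_homologicalInv]
  split_ifs with h
  · simp
  · have : κ - ((d 1 : ℂ) - d 2) ≠ 0 := fun h' => h (sub_eq_zero.1 h').symm
    field_simp
    ring

theorem OrdGE.weightPart {n : ℕ} {f : Series} (hf : OrdGE n f) (κ : ℂ) :
    OrdGE n (weightPart κ f) := fun d hd => by
  rw [coeff_weightPart, hf d hd, ite_self]

theorem OrdGE.homologicalInv {n : ℕ} {f : Series} (hf : OrdGE n f) (lam κ : ℂ) :
    OrdGE n (homologicalInv lam κ f) := fun d hd => by
  rw [coeff_homologicalInv, hf d hd, zero_div, ite_self]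

theorem weightPart_sub (κ : ℂ) (f g : Series) :
    weightPart κ f - weightPart κ g = weightPart κ (f - g) := by
  ext d
  simp only [map_sub, coeff_weightPart]
  split_ifs <;> simp

theorem homologicalInv_sub (lam κ : ℂ) (f g : Series) :
    homologicalInv lam κ f - homologicalInv lam κ g = homologicalInv lam κ (f - g) := by
  ext d
  simp only [map_sub, coeff_homologicalInv]
  split_ifs
  · simp
  · ring

theorem OrdGE.lie {m n : ℕ} {Y : VField} (hY : ∀ i, OrdGE m (Y i)) {f : Series}
    (hf : OrdGE (n + 1) f) : OrdGE (m + n) (lie Y f) :=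
  .sum fun i _ => (hY i).mul (hf.pderiv i)

/-- Poincaré–Dulac: a prepared vector field is conjugate to a resonant one. -/
theorem IsPrepared.exists_isResonant {lam : ℂ} (hlam : lam ≠ 0) {Z : VField}
    (hZ : IsPrepared lam Z) : ∃ (Ψ : FMap) (N : VField), IsFibered Ψ ∧ N 0 = X 0 ^ 2 ∧
      IsResonant N ∧ HasLinearPart lam N ∧ IsPushforward Ψ N Z := by
  obtain ⟨F₁, F₂, hF1, hF2, rfl⟩ := hZ
  let F : VField := ![0, F₁, F₂]
  -- One unknown `g` encodes both the conjugacy `X + S g` (nonresonant part, divided by the small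
  -- factors) and the nonlinear part `R g` of the resonant field.
  let S : VField → VField :=
    fun g => ![0, homologicalInv lam 1 (g 1), homologicalInv lam (-1) (g 2)]
  let R : VField → VField := fun g => ![X 0 ^ 2, weightPart 1 (g 1), weightPart (-1) (g 2)]
  have hF : ∀ i, OrdGE 2 (F i) := by
    intro i
    fin_cases i
    · exact .zero
    · exact ordGE_iff_le_order.2 hF1
    · exact ordGE_iff_le_order.2 hF2
  have hX2 : OrdGE 2 (X 0 ^ 2 : Series) := by rw [pow_two]; exact (OrdGE.X 0).mul (OrdGE.X 0)
  have hS : ∀ {n : ℕ} {g : VField}, (∀ i, OrdGE n (g i)) → ∀ i, OrdGE n (S g i) := by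
    intro n g hg i
    fin_cases i
    · exact .zero
    · exact (hg 1).homologicalInv _ _
    · exact (hg 2).homologicalInv _ _
  have hSsub : ∀ {n : ℕ} {f g : VField}, (∀ i, OrdGE n (f i - g i)) →
      ∀ i, OrdGE n (S f i - S g i) := by
    intro n f g h i
    fin_cases i
    · exact OrdGE.zero.sub .zero
    · change OrdGE n (homologicalInv _ _ _ - homologicalInv _ _ _)
      rw [homologicalInv_sub]; exact (h 1).homologicalInv _ _
    · change OrdGE n (homologicalInv _ _ _ - homologicalInv _ _ _)
      rw [homologicalInv_sub]; exact (h 2).homologicalInv _ _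
  have hR : ∀ {g : VField}, (∀ i, OrdGE 2 (g i)) → ∀ i, OrdGE 2 (R g i) := by
    intro g hg i
    fin_cases i
    · exact hX2
    · exact (hg 1).weightPart _
    · exact (hg 2).weightPart _
  have hRsub : ∀ {n : ℕ} {f g : VField}, (∀ i, OrdGE n (f i - g i)) →
      ∀ i, OrdGE n (R f i - R g i) := by
    intro n f g h i
    fin_cases i
    · change OrdGE n (X 0 ^ 2 - X 0 ^ 2); rw [sub_self]; exact .zero
    · change OrdGE n (weightPart _ _ - weightPart _ _)
      rw [weightPart_sub]; exact (h 1).weightPart _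
    · change OrdGE n (weightPart _ _ - weightPart _ _)
      rw [weightPart_sub]; exact (h 2).weightPart _
  have hΨ : ∀ {g : VField}, (∀ i, OrdGE 2 (g i)) → ∀ i, OrdGE 1 (X i + S g i) := fun hg i =>
    (OrdGE.X i).add ((hS hg i).mono (by omega))
  -- By the homological equation, conjugacy amounts to `g = F ∘ Ψ - (R g)(S g)`, a contraction since
  -- `F`, `R g` and `S g` have order 2.
  obtain ⟨g, hg, hfix⟩ := exists_fixedPoint
    (fun (g : VField) i => pull (fun j => X j + S g j) (F i) - lie (R g) (S g i)) 2
    (fun g hg i => ((hF i).pull (hΨ hg)).sub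
      ((OrdGE.lie (hR hg) (n := 1) (hS hg i)).mono (by omega)))
    (fun f g n hf hg hn h i => by
      have e1 : OrdGE (n + 1) (pull (fun j => X j + S f j) (F i) -
          pull (fun j => X j + S g j) (F i)) :=
        OrdGE.subst_sub_subst (hΨ hf) (hΨ hg) (fun j => by simpa using hSsub h j) (hF i)
      have e2 : OrdGE (n + 1) (lie (R f) (S f i - S g i)) := by
        obtain ⟨m, rfl⟩ := Nat.exists_eq_add_of_le' (show 1 ≤ n by omega)
        exact (OrdGE.lie (hR hf) (hSsub h i)).mono (by omega)
      have e3 : OrdGE (n + 1) (lie (fun j => R f j - R g j) (S g i)) :=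
        OrdGE.lie (hRsub h) (hS hg i)
      convert e1.sub (e2.add e3) using 1
      simp only [lie_eq, map_sub]
      ring)
  have hfix' : ∀ i, pull (fun j => X j + S g j) (F i) = g i + lie (R g) (S g i) := fun i => by
    rw [← congrFun hfix i]; ring
  have hΨ' := hΨ hg
  set Ψ : FMap := fun j => X j + S g j with hΨdef
  have hΨ0 : Ψ 0 = X 0 := add_zero _
  have hjac : constantCoeff (jac Ψ) = 1 := by
    have h1 := fun i => ordGE_one_iff.1 ((hS hg 1).pderiv i)
    have h2 := fun i => ordGE_one_iff.1 ((hS hg 2).pderiv i)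
    simp [jac, hΨdef, h1, h2]
  refine ⟨Ψ, ![X 0 ^ 2, -(C lam * X 1) + weightPart 1 (g 1), C lam * X 2 + weightPart (-1) (g 2)],
    isFibered_iff.2 ⟨hΨ', by simp [hjac], hΨ0⟩, rfl, ⟨?_, ?_, ?_⟩, ⟨hX2, ?_, ?_⟩,
    isPushforward_iff.2 fun i => ?_⟩
  · change lie torus (X 0 ^ 2) = 0
    rw [pow_two, lie_mul, lie_X]
    simp [torus]
  · change lie torus (-(C lam * X 1) + weightPart 1 (g 1)) = -(C lam * X 1) + weightPart 1 (g 1)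
    rw [lie_add, lie_torus_weightPart, ← neg_mul, ← map_neg, lie_mul, lie_C, lie_X]
    simp [torus]
  · change lie torus (C lam * X 2 + weightPart (-1) (g 2)) =
      -(C lam * X 2 + weightPart (-1) (g 2))
    rw [lie_add, lie_torus_weightPart, lie_mul, lie_C, lie_X]
    simp [torus]
    ring
  · simpa using (hg 1).weightPart 1
  · simpa using (hg 2).weightPart (-1)
  · set N : VField :=
      ![X 0 ^ 2, -(C lam * X 1) + weightPart 1 (g 1), C lam * X 2 + weightPart (-1) (g 2)]
    have hN : ∀ f, lie N f = lie (R g) f - C lam * lie torus f := by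
      intro f
      rw [lie_torus, lie_eq, lie_eq]
      simp [N, R]
      ring
    fin_cases i
    · change lie N (Ψ 0) = pull Ψ (X 0 ^ 2)
      rw [hΨ0, lie_X, pull_pow hΨ', pull_X hΨ', show S g 0 = 0 from rfl, add_zero]
      rfl
    · change lie N (X 1 + homologicalInv lam 1 (g 1)) = pull Ψ (-(C lam * X 1) + F 1)
      rw [pull_add hΨ', pull_neg hΨ', pull_mul hΨ', pull_C, pull_X hΨ', hfix', lie_add, lie_X, hN]
      have h1 := homologicalInv_spec hlam 1 (g 1)
      rw [map_one] at h1
      change -(C lam * X 1) + weightPart 1 (g 1) + _ = -(C lam * (X 1 + homologicalInv lam 1 (g 1)))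
        + (g 1 + lie (R g) (homologicalInv lam 1 (g 1)))
      linear_combination h1
    · change lie N (X 2 + homologicalInv lam (-1) (g 2)) = pull Ψ (C lam * X 2 + F 2)
      rw [pull_add hΨ', pull_mul hΨ', pull_C, pull_X hΨ', hfix', lie_add, lie_X, hN]
      have h1 := homologicalInv_spec hlam (-1) (g 2)
      rw [map_neg, map_one] at h1
      change C lam * X 2 + weightPart (-1) (g 2) + _ =
        C lam * (X 2 + homologicalInv lam (-1) (g 2))
        + (g 2 + lie (R g) (homologicalInv lam (-1) (g 2)))
      linear_combination h1

/-! ### Correction of the Jacobian -/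

/-- A torus-invariant series is the Jacobian of a map `(x, y₁, y₂) ↦ (x, τ y₁, y₂)`. -/
theorem exists_jac_eq {J : Series} (hJ : lie torus J = 0) :
    ∃ τ : Series, lie torus τ = 0 ∧ τ + X 1 * pd 1 τ = J ∧
      constantCoeff τ = constantCoeff J := by
  have hJ' : ∀ d : Fin 3 →₀ ℕ, (d 1 : ℂ) - d 2 ≠ 0 → coeff d J = 0 :=
    lie_torus_eq_iff.1 (by simpa using hJ)
  -- `1 + y₁∂₁` is diagonal on monomials, with eigenvalue `1 + d₁ ≠ 0`.
  let τ : Series := fun d => coeff d J / (1 + d 1)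
  have hτ : ∀ d, coeff d τ = coeff d J / (1 + d 1) := fun d => rfl
  refine ⟨τ, ?_, ?_, ?_⟩
  · have : lie torus τ = C 0 * τ := lie_torus_eq_iff.2 fun d hd => by rw [hτ, hJ' d hd, zero_div]
    simpa using this
  · ext d
    rw [map_add, coeff_X_mul_pd, hτ]
    have : (1 + d 1 : ℂ) ≠ 0 := by
      rw [add_comm]; exact Nat.cast_add_one_ne_zero _
    field_simp
  · rw [← coeff_zero_eq_constantCoeff_apply, hτ]
    simp

/-- The Jacobian `J` of the Poincaré–Dulac map `Ψ` satisfies `N(J) = (x - fdiv N)J`, so it is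
torus-invariant. An equivariant `Φ` with the same Jacobian makes `Φ ∘ Ψ⁻¹` symplectic without
destroying resonance. -/
theorem exists_symplectic_isResonant {lam : ℂ} (hlam : lam ≠ 0) {Z : VField}
    (hZ : IsPrepared lam Z) (hdiv : fdiv Z = X 0) :
    ∃ (Θ : FMap) (N : VField), IsTransSymplectic Θ ∧ IsPushforward Θ Z N ∧ N 0 = X 0 ^ 2 ∧
      IsResonant N ∧ fdiv N = X 0 ∧ coeff (Finsupp.single 1 1) (N 1) = -lam := by
  obtain ⟨Ψ, N, hΨ, hN0, hres, hlin, hpush⟩ := hZ.exists_isResonant hlam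
  have hZ0 := hZ.hasLinearPart.1
  have htX0 : lie torus (X 0) = 0 := lie_X torus 0
  have htX1 : lie torus (X 1) = X 1 := lie_X torus 1
  have hJ : lie torus (jac Ψ) = 0 := by
    have h1 := pull_fdiv_mul_jac hΨ.ordGE hΨ.fib hpush (by simp [hN0]) (by simp [hN0])
    rw [hdiv, pull_X hΨ.ordGE, hΨ.fib] at h1
    have := hlin.lie_torus_eq hlam hres (κ := 0) (r := X 0 - fdiv N) (K := jac Ψ)
      (by simp [hlin.constantCoeff_fdiv]) (by rw [lie_sub, htX0, hres.lie_torus_fdiv, sub_zero])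
      (by rw [mul_zero, map_zero]; linear_combination -h1)
    simpa using this
  obtain ⟨τ, hτt, hτ, hτ0⟩ := exists_jac_eq hJ
  have hJ0 := (isFibered_iff.1 hΨ).2.1
  let Φ : FMap := ![X 0, X 1 * τ, X 2]
  have hΦord : ∀ i, OrdGE 1 (Φ i) := by
    intro i
    fin_cases i
    · exact OrdGE.X 0
    · exact (OrdGE.X 1).mul_right τ
    · exact OrdGE.X 2
  have hjac : jac Φ = jac Ψ := by
    rw [← hτ]
    simp [jac, Φ, Derivation.leibniz, add_comm]
  have hΦ : IsFibered Φ := isFibered_iff.2 ⟨hΦord, by rwa [hjac], rfl⟩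
  obtain ⟨N', hN'⟩ := exists_isPushforward hΦ.diffeo N
  obtain ⟨Ψ', hΨ', h1, h2⟩ := hΨ.exists_inverse
  have hΘ : IsTransSymplectic (comp Φ Ψ') := by
    refine isTransSymplectic_iff.2 ⟨hΦ.comp hΨ', ?_⟩
    rw [jac_comp hΨ'.ordGE hΨ'.fib, hjac, ← jac_comp hΨ'.ordGE hΨ'.fib, h1, jac_X]
  have hpush' : IsPushforward (comp Φ Ψ') Z N' :=
    (hpush.inverse hΨ.diffeo hΨ'.diffeo h2).comp hΨ'.ordGE hΦord hN'
  have hN'eq := isPushforward_iff.1 hN'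
  have hN'0 : N' 0 = X 0 ^ 2 := by
    apply pull_injective hΦ.diffeo
    rw [← hN'eq, pull_pow hΦord, pull_X hΦord]
    change lie N (X 0) = X 0 ^ 2
    rw [lie_X, hN0]
  have ht1 : lie torus (X 1 * τ) = X 1 * τ := by rw [lie_mul, hτt, htX1]; ring
  have htorus : IsPushforward Φ torus torus := by
    refine isPushforward_iff.2 fun i => ?_
    fin_cases i
    · change lie torus (X 0) = pull Φ 0
      rw [htX0, pull_zero]
    · change lie torus (X 1 * τ) = pull Φ (X 1)
      rw [ht1, pull_X hΦord]
      rfl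
    · change lie torus (X 2) = pull Φ (-X 2)
      rw [lie_X, pull_neg hΦord, pull_X hΦord]
      rfl
  have hres' : ∀ i, pull Φ (lie torus (N' i)) = lie N (lie torus (Φ i)) := fun i => by
    rw [← lie_pull hΦord htorus, ← hN'eq, hres.lie_comm]
  have hresN' : IsResonant N' := by
    refine ⟨?_, ?_, ?_⟩ <;> apply pull_injective hΦ.diffeo <;> rw [hres']
    · change lie N (lie torus (X 0)) = _
      rw [htX0, pull_zero]
      simpa using lie_C N 0
    · rw [← hN'eq]
      exact congrArg (lie N) ht1
    · rw [pull_neg hΦord, ← hN'eq]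
      change lie N (lie torus (X 2)) = -lie N (X 2)
      rw [lie_X]
      change lie N (-X 2) = _
      simp [lie_eq]
  refine ⟨comp Φ Ψ', N', hΘ, hpush', hN'0, hresN', ?_, ?_⟩
  · obtain ⟨hf, hj⟩ := isTransSymplectic_iff.1 hΘ
    apply pull_injective hf.diffeo
    have := pull_fdiv_mul_jac hf.ordGE hf.fib hpush' (by simp [hZ0]) (by simp [hZ0])
    rw [hj, lie_one, hdiv, mul_one, one_mul, add_zero] at this
    rw [this, pull_X hf.ordGE, hf.fib]
  -- The eigenvalue is unchanged: weight 1 leaves only `α y₁` in the linear part of `N' 1`, and the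
  -- `y₁`-coefficient of `N(y₁τ) = N' 1 ∘ Φ` gives `(α + λ)τ(0) = 0`.
  · have hwt : lie torus (N' 1) = C 1 * N' 1 := by simpa using hresN'.one
    rw [lie_torus_eq_iff] at hwt
    set α := coeff (Finsupp.single 1 1) (N' 1) with hα
    have hH : OrdGE 2 (N' 1 - C α * X 1) := by
      rw [ordGE_two_iff]
      refine ⟨?_, fun i => ?_⟩
      · rw [map_sub, ← coeff_zero_eq_constantCoeff_apply, hwt 0 (by simp)]
        simp
      · rw [← coeff_single_eq_constantCoeff_pd, map_sub, coeff_C_mul, coeff_single_X]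
        fin_cases i
        · simp [hwt (Finsupp.single 0 1) (by simp)]
        · simp [hα]
        · simp [hwt (Finsupp.single 2 1) (by simp; norm_num)]
    have e1 := hH.pull hΦord
    rw [pull_sub hΦord, pull_mul hΦord, pull_C, pull_X hΦord, ← hN'eq] at e1
    have hNord : ∀ i, OrdGE 1 (N i) := by
      intro i
      fin_cases i
      · exact hlin.zero.mono (by omega)
      · have := (hlin.one.mono (by omega : 1 ≤ 2)).sub ((OrdGE.X 1).mul_left (C lam))
        simpa using this
      · have := (hlin.two.mono (by omega : 1 ≤ 2)).add ((OrdGE.X 2).mul_left (C lam))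
        simpa using this
    have e2 : OrdGE 2 (X 1 * lie N τ) := by
      have : OrdGE 1 (lie N τ) := .sum fun i _ => (hNord i).mul_right _
      exact (OrdGE.X 1).mul this
    have e3 : OrdGE 2 (X 1 * (C (α + lam) * τ)) := by
      have := (e2.add (hlin.one.mul_right τ)).sub e1
      convert this using 1
      change _ = _ - (lie N (X 1 * τ) - C α * (X 1 * τ))
      rw [lie_mul, lie_X, map_add]
      ring
    have e4 := e3 (0 + Finsupp.single 1 1) (by simp)
    rw [coeff_add_single_X_mul, coeff_C_mul, coeff_zero_eq_constantCoeff_apply, hτ0] at e4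
    rcases mul_eq_zero.1 e4 with h | h
    · linear_combination h
    · exact absurd h hJ0

/-! ### Normalization of the resonant terms -/

/-- Solution of `(x ∂_x + y₂ ∂_{y₂}) t = s t` for a torus-invariant series `s`. -/
theorem exists_euler_eq {s : Series} (hs : lie torus s = 0) (hs0 : constantCoeff s = 0) :
    ∃ t : Series, lie torus t = 0 ∧ constantCoeff t = 1 ∧
      X 0 * pd 0 t + X 2 * pd 2 t = s * t := by
  -- Inverse of `x∂ₓ + y₂∂₂` on invariant monomials. At `d = 0` division by zero yields 0, harmless
  -- because `s·t` has no constant term.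
  let I : Series → Series := fun f d => if d 1 = d 2 then coeff d f / (d 0 + d 2) else 0
  have hI : ∀ f d, coeff d (I f) = if d 1 = d 2 then coeff d f / (d 0 + d 2) else 0 :=
    fun f d => rfl
  have hIord : ∀ {n : ℕ} {f : Series}, OrdGE n f → OrdGE n (I f) := fun hf d hd => by
    rw [hI, hf d hd, zero_div, ite_self]
  have hIsub : ∀ f g, I f - I g = I (f - g) := fun f g => by
    ext d
    simp only [map_sub, hI]
    split_ifs
    · ring
    · simp
  have hs1 := ordGE_one_iff.2 hs0
  -- With `t = 1 + u` the equation becomes `u = I(s(1 + u))`, contracting because `s(0) = 0`.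
  obtain ⟨u, hu, hfix⟩ := exists_fixedPoint (fun (u : Unit → Series) i => I (s * (1 + u i))) 1
    (fun u _ i => hIord (hs1.mul_right _))
    (fun f g n _ _ _ h i => by
      rw [hIsub]
      refine hIord ?_
      convert (hs1.mul (h i)).mono (by omega : n + 1 ≤ 1 + n) using 1
      ring)
  set t := 1 + u () with ht
  have hut : u () = I (s * t) := (congrFun hfix ()).symm
  have htcoeff : ∀ d, coeff d t = coeff d (1 : Series) + coeff d (I (s * t)) := fun d => by
    rw [← hut, ← map_add]
  have htt : lie torus t = 0 := by
    have h1 : lie torus (u ()) = C 0 * u () := lie_torus_eq_iff.2 fun d hd => by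
      rw [hut, hI, if_neg]
      intro h
      exact hd (by rw [h, sub_self])
    rw [ht, lie_add, lie_one, h1]
    simp
  refine ⟨t, htt, by simp [ht, ordGE_one_iff.1 (hu ())], ?_⟩
  have hst : lie torus (s * t) = C 0 * (s * t) := by
    rw [lie_mul, hs, htt]
    simp
  rw [lie_torus_eq_iff] at hst
  ext d
  rw [map_add, coeff_X_mul_pd, coeff_X_mul_pd, htcoeff]
  have h1 : ∀ i : Fin 3, (d i : ℂ) * coeff d (1 : Series) = 0 := fun i => by
    rw [← coeff_X_mul_pd]
    simp
  have h2 : ((d 0 : ℂ) + d 2) * coeff d (I (s * t)) = coeff d (s * t) := by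
    rw [hI]
    split_ifs with h
    · by_cases h0 : (d 0 : ℂ) + d 2 = 0
      · have h0' : d 0 + d 2 = 0 := by exact_mod_cast h0
        have : d = 0 := by
          ext i
          fin_cases i <;> simp <;> omega
        rw [h0, this]
        simp [hs0]
      · field_simp
    · rw [hst d, mul_zero]
      rw [sub_ne_zero]
      exact_mod_cast h
  linear_combination h2 + h1 0 + h1 2

/-- Weights force `N 1 = y₁P₁` and `N 2 = y₂P₂` with invariant `Pᵢ`. The map `(x, t y₁, t⁻¹y₂)`
preserves `v`, is symplectic for invariant `t`, and adds `N(t)/t` to `P₁`. -/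
theorem exists_hasNormalForm_of_isResonant {lam : ℂ} {N : VField} (h0 : N 0 = X 0 ^ 2)
    (hres : IsResonant N) (hdiv : fdiv N = X 0)
    (hlam : coeff (Finsupp.single 1 1) (N 1) = -lam) :
    ∃ (a₁ a₂ : ℂ) (c : PowerSeries ℂ) (Φ : FMap), a₁ + a₂ = 1 ∧
      PowerSeries.constantCoeff c = 0 ∧ IsTransSymplectic Φ ∧
      IsPushforward Φ N (normalForm lam a₁ a₂ c) := by
  have htX0 : lie torus (X 0) = 0 := lie_X torus 0
  have htX1 : lie torus (X 1) = X 1 := lie_X torus 1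
  have htX2 : lie torus (X 2) = -X 2 := lie_X torus 2
  have hw1 : lie torus (N 1) = C 1 * N 1 := by simpa using hres.one
  have hw2 : lie torus (N 2) = C (-1) * N 2 := by simpa using hres.two
  rw [lie_torus_eq_iff] at hw1 hw2
  obtain ⟨P₁, hP1⟩ : X 1 ∣ N 1 := X_dvd_iff.2 fun d hd => hw1 d fun h => by
    rw [hd] at h
    have h' : ((d 2 + 1 : ℕ) : ℂ) = 0 := by push_cast at h ⊢; linear_combination -h
    exact Nat.succ_ne_zero _ (Nat.cast_eq_zero.1 h')
  obtain ⟨P₂, hP2⟩ : X 2 ∣ N 2 := X_dvd_iff.2 fun d hd => hw2 d fun h => by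
    rw [hd] at h
    have h' : ((d 1 + 1 : ℕ) : ℂ) = 0 := by push_cast at h ⊢; linear_combination h
    exact Nat.succ_ne_zero _ (Nat.cast_eq_zero.1 h')
  have ht1 : lie torus P₁ = 0 := by
    have := hres.one
    rw [hP1, lie_mul, htX1] at this
    apply mul_left_cancel₀ (X_ne_zero 1)
    linear_combination this
  have ht2 : lie torus P₂ = 0 := by
    have := hres.two
    rw [hP2, lie_mul, htX2] at this
    apply mul_left_cancel₀ (X_ne_zero 2)
    linear_combination this
  -- By invariance `y₁∂₁P₁ = y₂∂₂P₁`, so the divergence is `(1 + y₂∂₂)(P₁ + P₂)`; this operator is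
  -- injective and fixes `x`.
  have hsum : P₁ + P₂ = X 0 := by
    have h1 : P₁ + P₂ + X 2 * pd 2 (P₁ + P₂) = X 0 := by
      rw [← hdiv, fdiv, hP1, hP2]
      rw [lie_torus] at ht1
      simp only [Derivation.leibniz, smul_eq_mul, map_add, pderiv_X_self]
      linear_combination -ht1
    ext d
    have h2 := congrArg (coeff d) h1
    have h3 : (d 2 : ℂ) * coeff d (X 0 : Series) = 0 := by
      rw [← coeff_X_mul_pd]
      simp
    rw [map_add (coeff d) (P₁ + P₂), coeff_X_mul_pd] at h2
    have h4 : (d 2 + 1 : ℂ) ≠ 0 := Nat.cast_add_one_ne_zero _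
    apply mul_left_cancel₀ h4
    linear_combination h2 - h3
  have hP10 : coeff 0 P₁ = -lam := by
    rw [← hlam, hP1, ← coeff_add_single_X_mul 1 0, zero_add]
  let a₁ : ℂ := coeff (Finsupp.single 0 1) P₁
  let c : PowerSeries ℂ := PowerSeries.mk fun k =>
    if k = 0 then 0 else -coeff (Finsupp.single 1 k + Finsupp.single 2 k) P₁
  have hc : PowerSeries.constantCoeff c = 0 := by
    rw [← PowerSeries.coeff_zero_eq_constantCoeff_apply, PowerSeries.coeff_mk, if_pos rfl]
  have htr : lie torus (C (-lam) + C a₁ * X 0 - ofV c - P₁) = 0 := by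
    rw [lie_sub, lie_sub, lie_add, lie_mul, lie_C, lie_C, htX0, lie_torus_ofV, ht1]
    ring
  have htr' : lie torus (C (-lam) + C a₁ * X 0 - ofV c - P₁) =
      C 0 * (C (-lam) + C a₁ * X 0 - ofV c - P₁) := by simpa using htr
  -- At `x = 0` an invariant series depends on `v` alone, and `-λ - c(v)` was chosen to be `P₁`
  -- there; `a₁` then makes `s(0) = 0`.
  obtain ⟨s, hs⟩ : X 0 ∣ C (-lam) + C a₁ * X 0 - ofV c - P₁ := X_dvd_iff.2 fun d hd => by
    by_cases h12 : d 1 = d 2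
    · rw [map_sub, map_sub, map_add, coeff_ofV, if_pos ⟨hd, h12⟩, mul_comm, coeff_X_mul_eq_zero hd,
        PowerSeries.coeff_mk]
      have hdd : d = Finsupp.single 1 (d 1) + Finsupp.single 2 (d 1) := by
        ext i
        fin_cases i <;> simp [hd, h12]
      by_cases h1 : d 1 = 0
      · have : d = 0 := by rw [hdd, h1]; simp
        rw [this, hP10]
        simp
      · rw [if_neg h1, ← hdd, coeff_C, if_neg]
        · ring
        · rintro rfl
          exact h1 rfl
    · refine lie_torus_eq_iff.1 htr' d ?_
      rw [sub_ne_zero]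
      exact_mod_cast h12
  have hts : lie torus s = 0 := by
    rw [hs, lie_mul, htX0] at htr
    apply mul_left_cancel₀ (X_ne_zero 0)
    linear_combination htr
  have hs0 : constantCoeff s = 0 := by
    rw [← coeff_zero_eq_constantCoeff_apply, ← coeff_add_single_X_mul 0 0, ← hs, zero_add, map_sub,
      map_sub, map_add, coeff_ofV, coeff_C_mul, coeff_single_X, coeff_C]
    simp [a₁]
  obtain ⟨t, htt, ht0, ht⟩ := exists_euler_eq hts hs0
  have hinv : t * t⁻¹ = 1 := MvPowerSeries.mul_inv_cancel t (by rw [ht0]; exact one_ne_zero)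
  have hinvt : lie torus t⁻¹ = 0 := by
    have := congrArg (lie torus) hinv
    rw [lie_mul, htt, lie_one] at this
    linear_combination t⁻¹ * this - lie torus t⁻¹ * hinv
  -- Invariance of `t` and `P₁ + P₂ = x` reduce `N(t)` to `x(x∂ₓ + y₂∂₂)t`.
  have hNt : lie N t = X 0 * s * t := by
    rw [lie_eq, h0, hP1, hP2]
    rw [lie_torus] at htt
    linear_combination X 0 * ht + P₁ * htt + X 2 * pd 2 t * hsum
  have hNinv : lie N t⁻¹ = -(X 0 * s * t⁻¹) := by
    have := congrArg (lie N) hinv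
    rw [lie_mul, hNt, lie_one] at this
    linear_combination t⁻¹ * this - (lie N t⁻¹ + X 0 * s * t⁻¹) * hinv
  let Φ : FMap := ![X 0, X 1 * t, X 2 * t⁻¹]
  have hΦord : ∀ i, OrdGE 1 (Φ i) := by
    intro i
    fin_cases i
    · exact OrdGE.X 0
    · exact (OrdGE.X 1).mul_right _
    · exact (OrdGE.X 2).mul_right _
  have hv : Φ 1 * Φ 2 = X 1 * X 2 := by
    change X 1 * t * (X 2 * t⁻¹) = X 1 * X 2
    linear_combination X 1 * X 2 * hinv
  have hjac : jac Φ = 1 := by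
    have h1 : lie torus (Φ 1) = Φ 1 := by
      change lie torus (X 1 * t) = X 1 * t
      rw [lie_mul, htt, htX1]; ring
    have h2 : lie torus (Φ 2) = -Φ 2 := by
      change lie torus (X 2 * t⁻¹) = -(X 2 * t⁻¹)
      rw [lie_mul, hinvt, htX2]; ring
    have h3 := mul_jac_of_lie_torus h1 h2
    rw [hv] at h3
    apply mul_left_cancel₀ (mul_ne_zero (X_ne_zero 1) (X_ne_zero 2))
    rw [h3]
    simp [Derivation.leibniz]
    ring
  have hΦ : IsFibered Φ := isFibered_iff.2 ⟨hΦord, by simp [hjac], rfl⟩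
  have hΦV : pull Φ (ofV c) = ofV c := by rw [pull_ofV hΦord, hv, ofV]
  refine ⟨a₁, 1 - a₁, c, Φ, by ring, hc, isTransSymplectic_iff.2 ⟨hΦ, hjac⟩,
    isPushforward_iff.2 fun i => ?_⟩
  fin_cases i
  · change lie N (X 0) = pull Φ (X 0 ^ 2)
    rw [lie_X, h0, pull_pow hΦord, pull_X hΦord]
    rfl
  · change lie N (X 1 * t) = pull Φ ((-C lam + C a₁ * X 0 - ofV c) * X 1)
    rw [pull_mul hΦord, pull_sub hΦord, pull_add hΦord, pull_mul hΦord, pull_neg hΦord, pull_C,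
      pull_C, pull_X hΦord, pull_X hΦord, hΦV, lie_mul, lie_X, hP1, hNt]
    change _ = (-C lam + C a₁ * X 0 - ofV c) * (X 1 * t)
    rw [map_neg] at hs
    linear_combination -X 1 * t * hs
  · change lie N (X 2 * t⁻¹) = pull Φ ((C lam + C (1 - a₁) * X 0 + ofV c) * X 2)
    rw [pull_mul hΦord, pull_add hΦord, pull_add hΦord, pull_mul hΦord, pull_C,
      pull_C, pull_X hΦord, pull_X hΦord, hΦV, lie_mul, lie_X, hP2, hNinv]
    change _ = (C lam + C (1 - a₁) * X 0 + ofV c) * (X 2 * t⁻¹)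
    rw [map_neg] at hs
    rw [map_sub, map_one]
    linear_combination X 2 * t⁻¹ * hs + X 2 * t⁻¹ * hsum

/-- Since the given conjugacy fixes `x`, the component `x²` passes back to `Y`, which yields
divergence `x`; Jacobian 1 then carries this divergence to the prepared field. -/
theorem IsTransHamSaddleNode.exists_hasNormalForm {lam : ℂ} {Y : VField}
    (hY : IsTransHamSaddleNode lam Y) : Y 0 = X 0 ^ 2 ∧ fdiv Y = X 0 ∧
      ∃ (a₁ a₂ : ℂ) (c : PowerSeries ℂ), HasNormalForm Y lam a₁ a₂ c := by
  obtain ⟨hlam, hham, Φ, Z, hΦ, hpush, hZ⟩ := hY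
  obtain ⟨hf, hj⟩ := isTransSymplectic_iff.1 hΦ
  have hZ0 := hZ.hasLinearPart.1
  have hY0 : Y 0 = X 0 ^ 2 := by
    have := isPushforward_iff.1 hpush 0
    rwa [hZ0, pull_pow hf.ordGE, pull_X hf.ordGE, hf.fib, lie_X] at this
  have hdivY := hham.fdiv_eq hY0
  have hdivZ : fdiv Z = X 0 := by
    apply pull_injective hf.diffeo
    have := pull_fdiv_mul_jac hf.ordGE hf.fib hpush (by simp [hY0]) (by simp [hY0])
    rw [hj, lie_one, hdivY, mul_one, one_mul, add_zero] at this
    rw [this, pull_X hf.ordGE, hf.fib]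
  obtain ⟨Θ, N, hΘ, hZN, hN0, hres, hdivN, hN1⟩ := exists_symplectic_isResonant hlam hZ hdivZ
  obtain ⟨a₁, a₂, c, Φ', ha, hc, hΦ', hN'⟩ :=
    exists_hasNormalForm_of_isResonant hN0 hres hdivN hN1
  have hΘ' := (isTransSymplectic_iff.1 hΘ).1.ordGE
  exact ⟨hY0, hdivY, a₁, a₂, c, hlam, ha, hc, comp Φ' (comp Θ Φ), hΦ'.comp (hΘ.comp hΦ),
    (hpush.comp hf.ordGE hΘ' hZN).comp (comp_ordGE hf.ordGE hΘ') hΦ'.diffeo.ordGE hN'⟩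

end SaddleNode

end

theorem theorem3 (lam : ℂ) (Y : SaddleNode.VField)
    (hY : SaddleNode.IsTransHamSaddleNode lam Y) :
    ∃ (a₁ a₂ : ℂ) (c : PowerSeries ℂ),
      SaddleNode.HasNormalForm Y lam a₁ a₂ c ∧
      (∀ r : ℂ, SaddleNode.HasResidue Y r ↔ r = a₁ + a₂) ∧
      (∀ (b₁ b₂ : ℂ) (d : PowerSeries ℂ),
        SaddleNode.HasNormalForm Y lam b₁ b₂ d → b₁ = a₁ ∧ b₂ = a₂ ∧ d = c) ∧
      (∀ (mu b₁ b₂ : ℂ) (d : PowerSeries ℂ),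
        SaddleNode.HasNormalForm Y mu b₁ b₂ d ↔
          (mu = lam ∧ b₁ = a₁ ∧ b₂ = a₂ ∧ d = c) ∨
          (mu = -lam ∧ b₁ = a₂ ∧ b₂ = a₁ ∧ d = -(PowerSeries.rescale (-1) c))) := by
  obtain ⟨h0, hdiv, a₁, a₂, c, h⟩ := hY.exists_hasNormalForm
  exact ⟨a₁, a₂, c, h, SaddleNode.hasResidue_iff h0 hdiv h, fun _ _ _ => h.unique,
    SaddleNode.hasNormalForm_iff h⟩
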